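/- Let $d\ge 2$ be an integer and $c\in(0,1]$. Let $\overrightarrow{\mathbb T}_d$ be the homogeneous tree in which every vertex has $d+1$ neighbours, with a distinguished root and all edges directed away from the root (so the root has $d+1$ children and every other vertex has $d$ children). For $q>0$ with $dq<1$, consider the following frog model on $\overrightarrow{\mathbb T}_d$. There is one particle at each vertex; at time $0$ the particle at the root is active and all others are inactive. Each vertex $v$ carries a lifetime $\mathcal T_v$ with values in $\{0,1,2,\dots\}$ and $\mathbb P(\mathcal T_v\ge n)=c(dq)^n$ for all $n\ge1$, and a discrete-time random walk from $v$ that at each step jumps to a uniformly chosen child of its current vertex; all lifetimes and walks are independent. Once activated, the particle of $v$ performs the first $\mathcal T_v$ jumps of its walk, one per unit of time, and is then removed; an inactive particle is activated when an active particle visits its vertex. The model survives if at every time there is at least one active particle. Let $\theta(d,c,q)$ be the probability of survival and $$q_c(d)=q_c(d,c):=\inf\{q>0:\ dq<1,\ \theta(d,c,q)>0\}.$$ Then, for every $d\ge 2$ and $c\in(0,1]$, $$\frac{1}{d(c+1)-\left(\frac{c}{c+1}\right)^2}\le q_c(d),$$ and, for every $d\ge3$ and $c\in(0,1]$, $$q_c(d)\le\frac{F(c,d)-\sqrt{F(c,d)^2-224\,c^2(c+1)^2}}{16\,c^2},\qquad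 F(c,d):=7d(c+1)^3-8c^2 .$$ -/

import Mathlib

open MeasureTheory ProbabilityTheory

namespace FrogTree

/-- Vertices of the homogeneous tree in which every vertex has `d + 1` neighbours, rooted at
`root`. The root has the `d + 1` children `node i []`, and `node i l` has the `d` children
`node i (j :: l)`. Directing the edges away from the root, they go from a vertex to its
children. -/
inductive Vertex (d : ℕ) : Type
  | root : Vertex d
  | node (i : Fin (d + 1)) (l : List (Fin d)) : Vertex d

/-- The distance from a vertex to the root. -/
def Vertex.level {d : ℕ} : Vertex d → ℕ
  | .root => 0
  | .node _ l => l.length + 1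

/-- The randomness of one step of a walk: a child number to be used at the root, and a child number
to be used at the other vertices. -/
abbrev Step (d : ℕ) : Type := Fin (d + 1) × Fin d

/-- One step along a directed edge, to the child selected by `x`. -/
def Vertex.child {d : ℕ} : Vertex d → Step d → Vertex d
  | .root, x => .node x.1 []
  | .node i l, x => .node i (x.2 :: l)

/-- The walk on the directed tree that starts from `v` and uses the steps `ξ 0, ξ 1, …`. -/
def walk {d : ℕ} (v : Vertex d) (ξ : ℕ → Step d) : ℕ → Vertex d
  | 0 => v
  | n + 1 => (walk v ξ n).child (ξ n)

/-- The randomness of one particle: its lifetime (the number of jumps that it makes once it is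
active) and the steps of its walk. -/
abbrev Particle (d : ℕ) : Type := ℕ × (ℕ → Step d)

/-- A realization of the model: one particle at every vertex. -/
abbrev Config (d : ℕ) : Type := Vertex d → Particle d

/-- `ActivatedAt ω v t`: in the realization `ω`, the particle of `v` is activated at time `t`.
The particle of the root is active from time `0`; a particle activated at time `s` at `u`, with
lifetime `T`, is at the `n`-th vertex of its walk at time `s + n` for `n ≤ T`, and activates
the particle that sits there. Every jump leads away from the root, so the time is unique
(`ActivatedAt.eq_level`). -/
inductive ActivatedAt {d : ℕ} (ω : Config d) : Vertex d → ℕ → Prop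
  | root : ActivatedAt ω .root 0
  | visit {u : Vertex d} {s n : ℕ} (hu : ActivatedAt ω u s) (hn : n ≤ (ω u).1) :
      ActivatedAt ω (walk u (ω u).2 n) (s + n)

theorem level_walk {d : ℕ} (v : Vertex d) (ξ : ℕ → Step d) (n : ℕ) :
    (walk v ξ n).level = v.level + n := by
  induction n with
  | zero => rfl
  | succ n ih =>
    have h : ∀ (w : Vertex d) (x : Step d), (w.child x).level = w.level + 1 := by
      rintro (_ | _) x <;> simp [Vertex.child, Vertex.level]
    rw [walk, h, ih]; rfl

theorem ActivatedAt.eq_level {d : ℕ} {ω : Config d} {v : Vertex d} {t : ℕ}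
    (h : ActivatedAt ω v t) : t = v.level := by
  induction h with
  | root => rfl
  | visit hu hn ih => rw [level_walk, ih]

/-- Survival: at every time `t` there is an active particle, that is, a particle which has been
activated at a time `s ≤ t` and which is not removed before time `t`. -/
def Survives {d : ℕ} (ω : Config d) : Prop :=
  ∀ t : ℕ, ∃ (v : Vertex d) (s : ℕ), ActivatedAt ω v s ∧ s ≤ t ∧ t ≤ s + (ω v).1

/-- The parameters for which the model makes sense: `d ≥ 2`, `c ∈ (0, 1]`, `q > 0`, and
`d q < 1`, so that `n ↦ c (d q) ^ n`, `n ≥ 1`, is the tail of a random variable with values in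
`ℕ`. -/
structure Admissible (d : ℕ) (c q : ℝ) : Prop where
  two_le : 2 ≤ d
  c_pos : 0 < c
  c_le_one : c ≤ 1
  q_pos : 0 < q
  dq_lt_one : d * q < 1

/-- The prescribed tail `P(T ≥ n)` of the lifetime `T`. -/
noncomputable def tail (d : ℕ) (c q : ℝ) (n : ℕ) : ℝ :=
  if n = 0 then 1 else c * (d * q) ^ n

theorem Admissible.dq_pos {d : ℕ} {c q : ℝ} (h : Admissible d c q) : 0 < d * q := by
  have := h.two_le
  have := h.q_pos
  positivity

theorem Admissible.tail_anti {d : ℕ} {c q : ℝ} (h : Admissible d c q) (n : ℕ) :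
    0 ≤ tail d c q n - tail d c q (n + 1) := by
  have h0 := h.dq_pos
  have h1 := h.dq_lt_one
  have hc := h.c_pos
  have hc1 := h.c_le_one
  rcases Nat.eq_zero_or_pos n with rfl | hn
  · simp only [tail, if_true, Nat.zero_add, one_ne_zero, if_false, pow_one]
    nlinarith
  · simp only [tail, hn.ne', if_false, Nat.succ_ne_zero]
    have : 0 < (d * q) ^ n := by positivity
    rw [pow_succ]
    nlinarith [mul_pos hc this]

theorem Admissible.hasSum_tail {d : ℕ} {c q : ℝ} (h : Admissible d c q) (m : ℕ) :
    HasSum (fun n => tail d c q (n + m) - tail d c q (n + m + 1)) (tail d c q m) := by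
  rw [hasSum_iff_tendsto_nat_of_nonneg (fun n => h.tail_anti (n + m))]
  have hs : ∀ N : ℕ, ∑ n ∈ Finset.range N, (tail d c q (n + m) - tail d c q (n + m + 1))
      = tail d c q m - tail d c q (N + m) := by
    intro N
    induction N with
    | zero => simp
    | succ N ih => rw [Finset.sum_range_succ, ih, Nat.add_right_comm N 1 m]; ring
  simp only [hs]
  have ht : Filter.Tendsto (tail d c q) Filter.atTop (nhds 0) := by
    have := (tendsto_pow_atTop_nhds_zero_of_lt_one h.dq_pos.le h.dq_lt_one).const_mul c
    rw [mul_zero] at this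
    refine this.congr' ?_
    filter_upwards [Filter.eventually_gt_atTop 0] with n hn
    simp [tail, hn.ne']
  simpa using ((Filter.tendsto_add_atTop_iff_nat m).2 ht).const_sub (tail d c q m)

/-- The law of the lifetime `T`, given by `P(T = n) = P(T ≥ n) - P(T ≥ n + 1)`. -/
noncomputable def lifetime {d : ℕ} {c q : ℝ} (h : Admissible d c q) : PMF ℕ :=
  ⟨fun n => ENNReal.ofReal (tail d c q n - tail d c q (n + 1)), by
    have h1 := (h.hasSum_tail 0)
    have h2 : tail d c q 0 = 1 := by simp [tail]
    rw [h2] at h1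
    have h3 := ENNReal.ofReal_tsum_of_nonneg (fun n => h.tail_anti n) h1.summable
    rw [show ∑' n, (tail d c q n - tail d c q (n + 1)) = 1 from h1.tsum_eq,
      ENNReal.ofReal_one] at h3
    exact h3 ▸ ENNReal.summable.hasSum⟩

/-- The lifetime has the tail `P(T ≥ n) = c (d q) ^ n`, `n ≥ 1`. -/
theorem lifetime_tail {d : ℕ} {c q : ℝ} (h : Admissible d c q) (n : ℕ) (hn : 1 ≤ n) :
    (lifetime h).toMeasure {k | n ≤ k} = ENNReal.ofReal (c * (d * q) ^ n) := by
  have hT : tail d c q n = c * (d * q) ^ n := by simp [tail, (show n ≠ 0 by omega)]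
  have h1 := h.hasSum_tail n
  rw [← hT, ← h1.tsum_eq, ENNReal.ofReal_tsum_of_nonneg (fun k => h.tail_anti (k + n)) h1.summable,
    PMF.toMeasure_apply _ (MeasurableSet.of_discrete)]
  have hr : Set.range (fun k => k + n) = {k | n ≤ k} := by
    ext k
    constructor
    · rintro ⟨j, rfl⟩
      simp
    · intro hk
      exact ⟨k - n, Nat.sub_add_cancel hk⟩
  rw [← hr, ← tsum_subtype, tsum_range (g := fun k => k + n) (f := fun k => lifetime h k)
    (add_left_injective n)]
  rfl

/-- The law of one step: uniform, so that a walk jumps to each child of its current vertex with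
the same probability. -/
noncomputable def stepLaw (d : ℕ) : Measure (Step d) := uniformOn Set.univ

theorem Admissible.isProbabilityMeasure_stepLaw {d : ℕ} {c q : ℝ} (h : Admissible d c q) :
    IsProbabilityMeasure (stepLaw d) := by
  have : NeZero d := ⟨by have := h.two_le; omega⟩
  exact isProbabilityMeasure_uniformOn Set.finite_univ Set.univ_nonempty

/-- The law of one particle: its lifetime and the steps of its walk are all independent. -/
noncomputable def particleLaw {d : ℕ} {c q : ℝ} (h : Admissible d c q) : Measure (Particle d) :=
  haveI := h.isProbabilityMeasure_stepLaw
  (lifetime h).toMeasure.prod (Measure.infinitePi fun _ : ℕ => stepLaw d)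

instance {d : ℕ} {c q : ℝ} (h : Admissible d c q) : IsProbabilityMeasure (particleLaw h) := by
  have := h.isProbabilityMeasure_stepLaw
  unfold particleLaw
  infer_instance

/-- The law of the model: the particles at the different vertices are independent. -/
noncomputable def frogLaw {d : ℕ} {c q : ℝ} (h : Admissible d c q) : Measure (Config d) :=
  Measure.infinitePi fun _ : Vertex d => particleLaw h

/-- The probability of survival `θ(d, c, q)`. -/
noncomputable def survivalProb {d : ℕ} {c q : ℝ} (h : Admissible d c q) : ℝ :=
  (frogLaw h).real {ω | Survives ω}

/-- The critical parameter `q_c(d, c) = inf {q > 0 : θ(d, c, q) > 0}`. -/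
noncomputable def criticalQ (d : ℕ) (c : ℝ) : ℝ :=
  sInf {q : ℝ | ∃ h : Admissible d c q, 0 < survivalProb h}

/-- The expression `F(c, d) = 7 d (c + 1)³ - 8 c²`. -/
noncomputable def F (c : ℝ) (d : ℕ) : ℝ := 7 * d * (c + 1) ^ 3 - 8 * c ^ 2

end FrogTree

/-! Every jump leads away from the root, so whether a vertex `w` is activated depends only on the
particles on the path above it. The particle `j` generations above `w`, once active, visits `w` with
probability `c q^j` (at most this if it starts at the root). A particle that reaches `w` passes
through, and activates, all vertices on its way. Hence one may split according to the nearest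
ancestor whose particle would visit `w`; this involves independent particles, and the probability
`reachProb c q n` that activation travels down `n` given generations obeys a renewal equation
(`real_reach_succ`).

Thus `a n = d^n * reachProb c q n` is a renewal sequence with weights `c (dq)^(k+1) ∏_{1≤i≤k} (1 - c
q^i)` (`renewalCoeff`). If their sum is below `1`, then `a n → 0`, and a union bound over a
generation excludes survival (`survivalProb_eq_zero`). If the sum exceeds `1`, some `a m` with `m ≥
1` exceeds `1`, and looking at every `m`-th generation one finds an embedded supercritical branching
process (`survivalProb_pos`).

It remains to estimate the series. The product is at most its first factor and at least `1 - ∑ c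
q^i`; both estimates give geometric series and hence rational conditions on `q`
(`survivalProb_eq_zero_of_lt`, `survivalProb_pos_of_gt`). The first yields the lower bound for
`q_c`. The upper bound is the smaller root of a quadratic, at which the second condition is verified
through `supercritical_polynomial_bound`. -/

namespace FrogTree

section

variable {d : ℕ}

/-! ### Ancestors and walks in the tree. -/

/-- The parent of a vertex; the root is its own parent. -/
def Vertex.parent : Vertex d → Vertex d
  | .root => .root
  | .node _ [] => .root
  | .node i (_ :: l) => .node i l

/-- The ancestor of `w` that is `k` generations above it. -/
def Vertex.anc (k : ℕ) (w : Vertex d) : Vertex d := Vertex.parent^[k] w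

/-- The step randomness that leads from the parent of a vertex to that vertex. -/
def Vertex.stepSet : Vertex d → Set (Step d)
  | .root => ∅
  | .node i [] => {x | x.1 = i}
  | .node _ (j :: _) => {x | x.2 = j}

@[simp] theorem Vertex.anc_zero (w : Vertex d) : w.anc 0 = w := rfl

theorem Vertex.anc_add (j k : ℕ) (w : Vertex d) : w.anc (j + k) = (w.anc k).anc j :=
  Function.iterate_add_apply _ _ _ _

theorem Vertex.level_parent (w : Vertex d) : w.parent.level = w.level - 1 := by
  rcases w with _ | ⟨i, _ | ⟨j, l⟩⟩ <;> rfl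

theorem Vertex.level_anc (k : ℕ) (w : Vertex d) : (w.anc k).level = w.level - k := by
  induction k with
  | zero => rfl
  | succ k ih => rw [Nat.add_comm, anc_add]; simp [Vertex.anc] at *; rw [level_parent, ih]; omega

/-- Beyond `w.level` the ancestor map is constantly the root; the level bounds here and below
exclude this range. -/
theorem Vertex.anc_injOn {w : Vertex d} {i j : ℕ} (hi : i ≤ w.level) (hj : j ≤ w.level)
    (h : w.anc i = w.anc j) : i = j := by
  have := congrArg Vertex.level h
  rw [level_anc, level_anc] at this
  omega

theorem Vertex.child_eq_iff (u w : Vertex d) (x : Step d) :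
    u.child x = w ↔ u = w.parent ∧ 1 ≤ w.level ∧ x ∈ w.stepSet := by
  rcases u with _ | ⟨i, l⟩ <;> rcases w with _ | ⟨i', _ | ⟨j, l'⟩⟩ <;>
    simp [Vertex.child, Vertex.parent, Vertex.stepSet, Vertex.level] <;> tauto

theorem walk_eq_iff (u w : Vertex d) (ξ : ℕ → Step d) (k : ℕ) :
    walk u ξ k = w ↔ u = w.anc k ∧ k ≤ w.level ∧ ∀ i < k, ξ i ∈ (w.anc (k - 1 - i)).stepSet := by
  induction k generalizing w with
  | zero => simp [walk]
  | succ k ih =>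
    rw [walk, Vertex.child_eq_iff, ih, Vertex.level_parent]
    have h1 : ∀ n, w.parent.anc n = w.anc (n + 1) := fun n => (Vertex.anc_add n 1 w).symm
    simp only [h1]
    constructor
    · rintro ⟨⟨h2, h3, h4⟩, h5, h6⟩
      refine ⟨h2, by omega, fun i hi => ?_⟩
      rcases Nat.lt_succ_iff_lt_or_eq.1 hi with h | rfl
      · have := h4 i h
        rwa [show k - 1 - i + 1 = k + 1 - 1 - i by omega] at this
      · simpa using h6
    · rintro ⟨h2, h3, h4⟩
      refine ⟨⟨h2, by omega, fun i hi => ?_⟩, by omega, by simpa using h4 k (by omega)⟩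
      rw [show k - 1 - i + 1 = k + 1 - 1 - i by omega]
      exact h4 i (by omega)

/-! ### Activation along a single path. -/

/-- The particle of the `k`-th ancestor of `w`, if it is activated, visits `w`. -/
def Hit (ω : Config d) (k : ℕ) (w : Vertex d) : Prop :=
  k ≤ (ω (w.anc k)).1 ∧ walk (w.anc k) (ω (w.anc k)).2 k = w

/-- `w` is activated by the particles on the path from its `n`-th ancestor, included, if this
ancestor is activated. -/
inductive Reach (ω : Config d) : ℕ → Vertex d → Prop
  | refl (w : Vertex d) : Reach ω 0 w
  | step {n k : ℕ} {w : Vertex d} (h : Reach ω n (w.anc (k + 1))) (hk : Hit ω (k + 1) w) :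
      Reach ω (n + (k + 1)) w

/-- A particle that visits `w` has visited all vertices on its way. -/
theorem Hit.anc {ω : Config d} {k j : ℕ} {w : Vertex d} (h : Hit ω (j + k) w) :
    Hit ω j (w.anc k) := by
  obtain ⟨h1, h2⟩ := h
  rw [walk_eq_iff] at h2
  refine ⟨?_, ?_⟩
  · rw [← Vertex.anc_add]; omega
  · rw [walk_eq_iff]
    refine ⟨rfl, by rw [Vertex.level_anc]; omega, fun i hi => ?_⟩
    rw [← Vertex.anc_add, ← Vertex.anc_add]
    have := h2.2.2 i (by omega)
    rwa [show j + k - 1 - i = j - 1 - i + k by omega] at this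

theorem Reach.exists_hit {ω : Config d} {n : ℕ} {w : Vertex d} (h : Reach ω (n + 1) w) :
    ∃ k ≤ n, Reach ω (n - k) (w.anc (k + 1)) ∧ Hit ω (k + 1) w := by
  generalize hm : n + 1 = m at h
  cases h with
  | refl => omega
  | @step m k _ h hk =>
    refine ⟨k, by omega, ?_, hk⟩
    rwa [show n - k = m by omega]

/-- The particle on its way to `w` activates every vertex in between. So the activating ancestor can
be replaced by the nearest one whose particle hits `w`, which makes the decomposition below
disjoint. -/
theorem Reach.anc_of_hit {ω : Config d} {n j k : ℕ} {w : Vertex d} (hkj : k ≤ j) (hjn : j ≤ n)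
    (h : Reach ω (n - j) (w.anc j)) (hj : Hit ω j w) : Reach ω (n - k) (w.anc k) := by
  obtain ⟨i, rfl⟩ := Nat.exists_eq_add_of_le' hkj
  rcases i with _ | i
  · simpa using h
  · rw [show n - k = n - (i + 1 + k) + (i + 1) by omega]
    refine .step ?_ hj.anc
    rwa [← Vertex.anc_add]

/-- Decomposition according to the closest ancestor whose particle visits `w`. -/
theorem reach_succ_iff {ω : Config d} {n : ℕ} {w : Vertex d} :
    Reach ω (n + 1) w ↔ ∃ k ≤ n, (Reach ω (n - k) (w.anc (k + 1)) ∧ Hit ω (k + 1) w) ∧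
      ∀ i < k, ¬ Hit ω (i + 1) w := by
  constructor
  · intro h
    obtain ⟨j, hj, hr, hh⟩ := h.exists_hit
    classical
    have hex : ∃ k, Hit ω (k + 1) w := ⟨j, hh⟩
    have hle : Nat.find hex ≤ j := Nat.find_min' hex hh
    refine ⟨Nat.find hex, by omega, ⟨?_, Nat.find_spec hex⟩, fun i hi => Nat.find_min hex hi⟩
    have := Reach.anc_of_hit (n := n + 1) (j := j + 1) (k := Nat.find hex + 1) (by omega)
      (by omega) (by rwa [show n + 1 - (j + 1) = n - j by omega]) hh
    rwa [show n + 1 - (Nat.find hex + 1) = n - Nat.find hex by omega] at this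
  · rintro ⟨k, hk, ⟨h1, h2⟩, -⟩
    rw [show n + 1 = n - k + (k + 1) by omega]
    exact .step h1 h2

theorem ActivatedAt.reach {ω : Config d} {w : Vertex d} {t : ℕ} (h : ActivatedAt ω w t) :
    Reach ω w.level w := by
  induction h with
  | root => exact .refl _
  | @visit u s n hu hn ih =>
    rcases n with _ | n
    · exact ih
    · have h2 := ((walk_eq_iff u _ (ω u).2 (n + 1)).1 rfl).1
      rw [level_walk]
      exact .step (h2 ▸ ih) ⟨h2 ▸ hn, by rw [← h2]⟩

theorem Reach.activatedAt {ω : Config d} {n : ℕ} {w : Vertex d} (h : Reach ω n w)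
    (h' : ActivatedAt ω (w.anc n) (w.anc n).level) : ActivatedAt ω w w.level := by
  induction h with
  | refl w => exact h'
  | @step n k w h hk ih =>
    have h1 := (ih (by rwa [← Vertex.anc_add])).visit hk.1
    rw [hk.2] at h1
    have h3 := h1.eq_level
    rwa [h3] at h1

theorem ActivatedAt.exists_active {ω : Config d} {w : Vertex d} {N : ℕ} (h : ActivatedAt ω w N) :
    ∀ t ≤ N, ∃ (v : Vertex d) (s : ℕ), ActivatedAt ω v s ∧ s ≤ t ∧ t ≤ s + (ω v).1 := by
  induction h with
  | root =>
    intro t ht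
    exact ⟨.root, 0, .root, by omega, by omega⟩
  | @visit u s n hu hn ih =>
    intro t ht
    by_cases hs : t ≤ s
    · exact ih t hs
    · exact ⟨u, s, hu, by omega, by omega⟩

/-- A particle active at time `n` stands in generation `n`, and activates the vertex where it
stands. -/
theorem Survives.exists_reach {ω : Config d} (h : Survives ω) (n : ℕ) :
    ∃ w : Vertex d, w.level = n ∧ Reach ω n w := by
  obtain ⟨v, s, hv, hs, ht⟩ := h n
  have h1 := hv.visit (n := n - s) (by omega)
  have h2 := h1.eq_level
  have h3 := h1.reach
  rw [show s + (n - s) = n by omega] at h2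
  rw [← h2] at h3
  exact ⟨_, h2.symm, h3⟩

/-- The descendant of a vertex that is reached by the child choices `g`. -/
def Vertex.desc : Vertex d → List (Fin d) → Vertex d
  | .root, _ => .root
  | .node i l, g => .node i (g ++ l)

theorem Vertex.anc_node (i : Fin (d + 1)) (g l : List (Fin d)) :
    (Vertex.node i (g ++ l)).anc g.length = .node i l := by
  induction g with
  | nil => rfl
  | cons a g ih => rw [List.length_cons, anc_add]; exact ih

/-! ### Independence of disjoint families of particles. -/

/-- The σ-algebra generated by the particles of the vertices in `S`. -/
@[reducible]
def sigmaOn (S : Set (Vertex d)) : MeasurableSpace (Config d) :=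
  ⨆ v ∈ S, MeasurableSpace.comap (fun ω : Config d => ω v) inferInstance

theorem sigmaOn_mono {S T : Set (Vertex d)} (h : S ⊆ T) : sigmaOn S ≤ sigmaOn T :=
  biSup_mono h

theorem sigmaOn_le (S : Set (Vertex d)) : sigmaOn S ≤ (inferInstance : MeasurableSpace (Config d)) :=
  iSup₂_le fun v _ => (measurable_pi_apply v).comap_le

theorem measurableSet_sigmaOn_preimage {S : Set (Vertex d)} {v : Vertex d} (hv : v ∈ S)
    {A : Set (Particle d)} (hA : MeasurableSet A) :
    MeasurableSet[sigmaOn S] {ω : Config d | ω v ∈ A} := by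
  have h : MeasurableSpace.comap (fun ω : Config d => ω v) inferInstance ≤ sigmaOn S :=
    le_biSup (fun v => MeasurableSpace.comap (fun ω : Config d => ω v) inferInstance) hv
  exact h _ ⟨A, hA, rfl⟩

instance {c q : ℝ} (h : Admissible d c q) : IsProbabilityMeasure (frogLaw h) := by
  unfold frogLaw; infer_instance

theorem indep_sigmaOn {c q : ℝ} (h : Admissible d c q) {S T : Set (Vertex d)}
    (hST : Disjoint S T) : Indep (sigmaOn S) (sigmaOn T) (frogLaw h) := by
  refine indep_iSup_of_disjoint (fun v => (measurable_pi_apply v).comap_le) ?_ hST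
  exact iIndepFun_infinitePi (P := fun _ : Vertex d => particleLaw h)
    (X := fun (_ : Vertex d) (x : Particle d) => x) (fun _ => measurable_id)

theorem frogLaw_real_inter {c q : ℝ} (h : Admissible d c q) {S T : Set (Vertex d)}
    (hST : Disjoint S T) {A B : Set (Config d)} (hA : MeasurableSet[sigmaOn S] A)
    (hB : MeasurableSet[sigmaOn T] B) :
    (frogLaw h).real (A ∩ B) = (frogLaw h).real A * (frogLaw h).real B := by
  simp only [Measure.real]
  rw [(Indep_iff _ _ _).1 (indep_sigmaOn h hST) A B hA hB, ENNReal.toReal_mul]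

/-! ### Hitting probabilities. -/

/-- The particles at `w.anc k` that visit `w`. -/
def hitSet (k : ℕ) (w : Vertex d) : Set (Particle d) :=
  {n | k ≤ n} ×ˢ Set.pi (Finset.range k) (fun i => (w.anc (k - 1 - i)).stepSet)

theorem hit_iff {ω : Config d} {k : ℕ} {w : Vertex d} (hk : k ≤ w.level) :
    Hit ω k w ↔ ω (w.anc k) ∈ hitSet k w := by
  simp [Hit, walk_eq_iff, hk, hitSet, Set.mem_prod, Set.mem_pi]

theorem measurableSet_hitSet (k : ℕ) (w : Vertex d) : MeasurableSet (hitSet k w) :=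
  MeasurableSet.of_discrete.prod
    (MeasurableSet.pi (Finset.countable_toSet _) fun _ _ => MeasurableSet.of_discrete)

theorem measurableSet_hit {S : Set (Vertex d)} {k : ℕ} {w : Vertex d} (hk : k ≤ w.level)
    (hS : w.anc k ∈ S) : MeasurableSet[sigmaOn S] {ω : Config d | Hit ω k w} := by
  simp only [hit_iff hk]
  exact measurableSet_sigmaOn_preimage hS (measurableSet_hitSet k w)

theorem stepLaw_stepSet_node_cons [NeZero d] (i : Fin (d + 1)) (j : Fin d) (l : List (Fin d)) :
    stepLaw d (Vertex.node i (j :: l)).stepSet = (d : ENNReal)⁻¹ := by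
  have h1 : (Vertex.node i (j :: l)).stepSet = (Set.univ : Set (Fin (d + 1))) ×ˢ {j} := by
    ext x; simp [Vertex.stepSet]
  rw [stepLaw, uniformOn_univ, h1, Measure.count_apply MeasurableSet.of_discrete,
    Set.encard_prod, Set.encard_univ, Set.encard_singleton]
  have hd : (d : ENNReal) ≠ 0 := by simp [NeZero.ne d]
  simp only [mul_one, ENat.card_eq_coe_fintype_card, Fintype.card_fin, Fintype.card_prod]
  push_cast
  rw [ENNReal.div_eq_inv_mul, ENNReal.mul_inv (by simp) (by simp), mul_comm, ← mul_assoc,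
    ENNReal.mul_inv_cancel (by simp) (by finiteness), one_mul]

theorem stepLaw_stepSet_node_nil [NeZero d] (i : Fin (d + 1)) :
    stepLaw d (Vertex.node i []).stepSet = ((d : ENNReal) + 1)⁻¹ := by
  have h1 : (Vertex.node i []).stepSet = {i} ×ˢ (Set.univ : Set (Fin d)) := by
    ext x; simp [Vertex.stepSet]
  rw [stepLaw, uniformOn_univ, h1, Measure.count_apply MeasurableSet.of_discrete,
    Set.encard_prod, Set.encard_univ, Set.encard_singleton]
  have hd : (d : ENNReal) ≠ 0 := by simp [NeZero.ne d]
  simp only [one_mul, ENat.card_eq_coe_fintype_card, Fintype.card_fin, Fintype.card_prod]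
  push_cast
  rw [ENNReal.div_eq_inv_mul, ENNReal.mul_inv (by simp) (by simp), mul_assoc,
    ENNReal.inv_mul_cancel hd (by finiteness), mul_one]

theorem stepLaw_stepSet {w : Vertex d} [NeZero d] (hw : 2 ≤ w.level) :
    stepLaw d w.stepSet = (d : ENNReal)⁻¹ := by
  rcases w with _ | ⟨i, _ | ⟨j, l⟩⟩
  · simp [Vertex.level] at hw
  · simp [Vertex.level] at hw
  · exact stepLaw_stepSet_node_cons i j l

theorem stepLaw_stepSet_le {w : Vertex d} [NeZero d] (hw : 1 ≤ w.level) :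
    stepLaw d w.stepSet ≤ (d : ENNReal)⁻¹ := by
  rcases w with _ | ⟨i, _ | ⟨j, l⟩⟩
  · simp [Vertex.level] at hw
  · rw [stepLaw_stepSet_node_nil]; gcongr; exact le_self_add
  · exact (stepLaw_stepSet_node_cons i j l).le

theorem frogLaw_hit {c q : ℝ} (h : Admissible d c q) {k : ℕ} {w : Vertex d} (hk : k + 1 ≤ w.level) :
    frogLaw h {ω | Hit ω (k + 1) w} = ENNReal.ofReal (c * (d * q) ^ (k + 1)) *
      ∏ i ∈ Finset.range (k + 1), stepLaw d (w.anc i).stepSet := by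
  have := h.isProbabilityMeasure_stepLaw
  simp only [hit_iff hk]
  have h1 := (measurePreserving_eval_infinitePi (fun _ : Vertex d => particleLaw h)
    (w.anc (k + 1))).measure_preimage (measurableSet_hitSet (k + 1) w).nullMeasurableSet
  rw [show frogLaw h {ω | ω (w.anc (k + 1)) ∈ hitSet (k + 1) w} =
    particleLaw h (hitSet (k + 1) w) from h1, particleLaw, hitSet, Measure.prod_prod,
    lifetime_tail h _ (by omega), Measure.infinitePi_pi _ (fun _ _ => MeasurableSet.of_discrete)]
  congr 1
  -- The `i`-th step of the walk leads to `w.anc (k - i)`, so the factors come in reversed order.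
  exact Finset.prod_range_reflect (fun i => stepLaw d (w.anc i).stepSet) (k + 1)

/-- The factors `d` in the lifetime tail cancel the `1/d` of each step. Strictness in `hk` keeps the
start away from the root, where a step has probability `1/(d+1)`; including the root only an
inequality remains, as in `real_hit_le`. -/
theorem real_hit {c q : ℝ} (h : Admissible d c q) {k : ℕ} {w : Vertex d} (hk : k + 1 < w.level) :
    (frogLaw h).real {ω | Hit ω (k + 1) w} = c * q ^ (k + 1) := by
  have : NeZero d := ⟨by have := h.two_le; omega⟩
  have hd : (d : ℝ) ≠ 0 := by simp [NeZero.ne d]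
  have hc := h.c_pos
  have hq := h.q_pos
  rw [Measure.real, frogLaw_hit h hk.le, Finset.prod_congr rfl fun i hi =>
    stepLaw_stepSet (by rw [Vertex.level_anc]; have := Finset.mem_range.1 hi; omega)]
  rw [ENNReal.toReal_mul, ENNReal.toReal_ofReal (by positivity)]
  simp only [Finset.prod_const, Finset.card_range, ENNReal.toReal_pow, ENNReal.toReal_inv,
    ENNReal.toReal_natCast]
  rw [mul_assoc, ← mul_pow]
  congr 2
  field_simp

theorem real_hit_le {c q : ℝ} (h : Admissible d c q) {k : ℕ} {w : Vertex d} (hk : k + 1 ≤ w.level) :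
    (frogLaw h).real {ω | Hit ω (k + 1) w} ≤ c * q ^ (k + 1) := by
  have : NeZero d := ⟨by have := h.two_le; omega⟩
  have hd : (d : ℝ) ≠ 0 := by simp [NeZero.ne d]
  have hc := h.c_pos
  have hq := h.q_pos
  have h1 : frogLaw h {ω | Hit ω (k + 1) w} ≤ ENNReal.ofReal (c * (d * q) ^ (k + 1)) *
      ∏ i ∈ Finset.range (k + 1), (d : ENNReal)⁻¹ := by
    rw [frogLaw_hit h hk]
    gcongr with i hi
    exact stepLaw_stepSet_le (by rw [Vertex.level_anc]; have := Finset.mem_range.1 hi; omega)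
  refine (ENNReal.toReal_mono ?_ h1).trans (le_of_eq ?_)
  · refine ENNReal.mul_ne_top (by simp) ?_
    simp only [Finset.prod_const]
    exact ENNReal.pow_ne_top (by simp [NeZero.ne d])
  · rw [ENNReal.toReal_mul, ENNReal.toReal_ofReal (by positivity)]
    simp only [Finset.prod_const, Finset.card_range, ENNReal.toReal_pow, ENNReal.toReal_inv,
      ENNReal.toReal_natCast]
    rw [mul_assoc, ← mul_pow]
    congr 2
    field_simp

theorem real_hit_level_one_pos {c q : ℝ} (h : Admissible d c q) (i : Fin (d + 1)) :
    0 < (frogLaw h).real {ω | Hit ω 1 (.node i [])} := by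
  have : NeZero d := ⟨by have := h.two_le; omega⟩
  have hc := h.c_pos
  have hq := h.dq_pos
  rw [Measure.real, frogLaw_hit h (k := 0) (by simp [Vertex.level])]
  simp only [Nat.zero_add, Finset.prod_range_one, Vertex.anc_zero, stepLaw_stepSet_node_nil]
  rw [ENNReal.toReal_mul, ENNReal.toReal_ofReal (by positivity), pow_one]
  refine mul_pos (by positivity) (ENNReal.toReal_pos ?_ ?_) <;> simp

/-! ### The renewal equation for activation along a path. -/

/-- The ancestors of `w` that are between `a + 1` and `b` generations above it. -/
def ancestors (w : Vertex d) (a b : ℕ) : Set (Vertex d) :=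
  (fun i => w.anc i) '' Set.Ioc a b

theorem disjoint_ancestors {w : Vertex d} {a b a' b' : ℕ} (h : b ≤ a') (h' : b' ≤ w.level) :
    Disjoint (ancestors w a b) (ancestors w a' b') := by
  rw [Set.disjoint_left]
  rintro _ ⟨i, hi, rfl⟩ ⟨j, hj, hij⟩
  have := Vertex.anc_injOn (hj.2.trans h') ((hi.2.trans h).trans (hj.1.le.trans (hj.2.trans h'))) hij
  have h1 := hi.2
  have h2 := hj.1
  omega

theorem ancestors_anc (w : Vertex d) (m n : ℕ) :
    ancestors (w.anc m) 0 n ⊆ ancestors w m (m + n) := by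
  rintro _ ⟨i, hi, rfl⟩
  have h1 := hi.1
  have h2 := hi.2
  exact ⟨i + m, ⟨by omega, by omega⟩, Vertex.anc_add _ _ _⟩

theorem ancestors_mono (w : Vertex d) {a b a' b' : ℕ} (h : a' ≤ a) (h' : b ≤ b') :
    ancestors w a b ⊆ ancestors w a' b' :=
  Set.image_mono (Set.Ioc_subset_Ioc h h')

theorem measurableSet_reach (n : ℕ) (w : Vertex d) (hn : n ≤ w.level) :
    MeasurableSet[sigmaOn (ancestors w 0 n)] {ω : Config d | Reach ω n w} := by
  induction n using Nat.strong_induction_on generalizing w with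
  | _ n ih =>
  rcases n with _ | n
  · have : {ω : Config d | Reach ω 0 w} = Set.univ := Set.eq_univ_of_forall fun ω => .refl w
    rw [this]
    exact @MeasurableSet.univ _ (sigmaOn _)
  · have : {ω : Config d | Reach ω (n + 1) w} = ⋃ k, ⋃ _ : k ≤ n,
        {ω | Reach ω (n - k) (w.anc (k + 1))} ∩ {ω | Hit ω (k + 1) w} := by
      ext ω
      simp only [Set.mem_ofPred_eq, Set.mem_iUnion, Set.mem_inter_iff, exists_prop]
      refine ⟨fun h => h.exists_hit, ?_⟩
      rintro ⟨k, hk, h1, h2⟩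
      rw [show n + 1 = n - k + (k + 1) by omega]
      exact .step h1 h2
    rw [this]
    refine MeasurableSet.iUnion fun k => MeasurableSet.iUnion fun hk => MeasurableSet.inter ?_ ?_
    · refine sigmaOn_mono ?_ _ (ih (n - k) (by omega) (w.anc (k + 1))
        (by rw [Vertex.level_anc]; omega))
      exact (ancestors_anc w (k + 1) (n - k)).trans (ancestors_mono w (by omega) (by omega))
    · exact measurableSet_hit (by omega) ⟨k + 1, ⟨by omega, by omega⟩, rfl⟩

/-- The probability that a vertex is not visited by the particles of its first `k` ancestors
(in case that they are all activated). -/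
noncomputable def missProb (c q : ℝ) (k : ℕ) : ℝ := ∏ i ∈ Finset.range k, (1 - c * q ^ (i + 1))

/-- The probability that activation of a vertex leads to activation of a given descendant, `n`
generations below, by the particles on the path between them. -/
noncomputable def reachProb (c q : ℝ) : ℕ → ℝ
  | 0 => 1
  | n + 1 => ∑ k : Fin (n + 1), c * q ^ (k.1 + 1) * missProb c q k.1 * reachProb c q (n - k.1)

theorem reachProb_zero (c q : ℝ) : reachProb c q 0 = 1 := by rw [reachProb]

theorem reachProb_succ (c q : ℝ) (n : ℕ) : reachProb c q (n + 1) =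
    ∑ k ∈ Finset.range (n + 1), c * q ^ (k + 1) * missProb c q k * reachProb c q (n - k) := by
  rw [reachProb, ← Fin.sum_univ_eq_sum_range
    (fun k => c * q ^ (k + 1) * missProb c q k * reachProb c q (n - k))]

theorem measurableSet_miss (k : ℕ) (w : Vertex d) (hk : k ≤ w.level) :
    MeasurableSet[sigmaOn (ancestors w 0 k)] {ω : Config d | ∀ i < k, ¬ Hit ω (i + 1) w} := by
  simp only [Set.ofPred_forall]
  refine MeasurableSet.iInter fun i => MeasurableSet.iInter fun hi => MeasurableSet.compl ?_
  exact measurableSet_hit (by omega) ⟨i + 1, ⟨by omega, by omega⟩, rfl⟩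

theorem real_miss {c q : ℝ} (h : Admissible d c q) {k : ℕ} {w : Vertex d} (hk : k < w.level) :
    (frogLaw h).real {ω | ∀ i < k, ¬ Hit ω (i + 1) w} = missProb c q k := by
  induction k with
  | zero => simp [missProb]
  | succ k ih =>
    have h1 : {ω : Config d | ∀ i < k + 1, ¬ Hit ω (i + 1) w} =
        {ω | ∀ i < k, ¬ Hit ω (i + 1) w} ∩ {ω | Hit ω (k + 1) w}ᶜ := by
      ext ω
      simp only [Set.mem_ofPred_eq, Set.mem_inter_iff, Set.mem_compl_iff]
      exact Nat.forall_lt_succ_right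
    have h2 : MeasurableSet[sigmaOn (ancestors w k (k + 1))] {ω : Config d | Hit ω (k + 1) w} :=
      measurableSet_hit (by omega) ⟨k + 1, ⟨by omega, by omega⟩, rfl⟩
    rw [h1, frogLaw_real_inter h (disjoint_ancestors le_rfl hk.le) (measurableSet_miss k w (by omega))
      h2.compl, ih (by omega), probReal_compl_eq_one_sub (sigmaOn_le _ _ h2), real_hit h hk,
      missProb, missProb, Finset.prod_range_succ]

/-- For the nearest hitting ancestor `w.anc (k + 1)`, the three events "no miss fails below it", "it
hits" and "it is reached" depend on particles strictly below, at, and strictly above it, hence are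
independent. The factor `Hit` and the last factor stay unevaluated because the path may start at the
root. -/
theorem real_reach_succ {c q : ℝ} (h : Admissible d c q) {n : ℕ} {w : Vertex d}
    (hn : n + 1 ≤ w.level) :
    (frogLaw h).real {ω | Reach ω (n + 1) w} = ∑ k ∈ Finset.range (n + 1),
      (frogLaw h).real {ω | Hit ω (k + 1) w} * missProb c q k *
        (frogLaw h).real {ω | Reach ω (n - k) (w.anc (k + 1))} := by
  set A : ℕ → Set (Config d) := fun k => ({ω | Reach ω (n - k) (w.anc (k + 1))} ∩
    {ω | Hit ω (k + 1) w}) ∩ {ω | ∀ i < k, ¬ Hit ω (i + 1) w} with hA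
  have hR : ∀ k ≤ n, MeasurableSet[sigmaOn (ancestors w (k + 1) (n + 1))]
      {ω : Config d | Reach ω (n - k) (w.anc (k + 1))} := fun k hk =>
    sigmaOn_mono ((ancestors_anc w (k + 1) (n - k)).trans
      (ancestors_mono w le_rfl (by omega))) _
      (measurableSet_reach (n - k) (w.anc (k + 1)) (by rw [Vertex.level_anc]; omega))
  have hH : ∀ k ≤ n, MeasurableSet[sigmaOn (ancestors w k (k + 1))]
      {ω : Config d | Hit ω (k + 1) w} := fun k hk =>
    measurableSet_hit (by omega) ⟨k + 1, ⟨by omega, by omega⟩, rfl⟩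
  have hRH : ∀ k ≤ n, MeasurableSet[sigmaOn (ancestors w k (n + 1))]
      ({ω : Config d | Reach ω (n - k) (w.anc (k + 1))} ∩ {ω | Hit ω (k + 1) w}) := fun k hk =>
    MeasurableSet.inter (sigmaOn_mono (ancestors_mono w (by omega) le_rfl) _ (hR k hk))
      (sigmaOn_mono (ancestors_mono w le_rfl (by omega)) _ (hH k hk))
  have h1 : {ω : Config d | Reach ω (n + 1) w} = ⋃ k ∈ Finset.range (n + 1), A k := by
    ext ω
    simp only [hA, Set.mem_ofPred_eq, reach_succ_iff, Set.mem_iUnion, Set.mem_inter_iff,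
      Finset.mem_range, Nat.lt_succ_iff, exists_prop]
  rw [h1, measureReal_biUnion_finset]
  · refine Finset.sum_congr rfl fun k hk => ?_
    have hk' : k ≤ n := by have := Finset.mem_range.1 hk; omega
    simp only [hA]
    rw [Set.inter_comm, frogLaw_real_inter h (disjoint_ancestors le_rfl hn)
      (measurableSet_miss k w (by omega)) (hRH k hk'), Set.inter_comm,
      frogLaw_real_inter h (disjoint_ancestors le_rfl hn) (hH k hk') (hR k hk'),
      real_miss h (by omega)]
    ring
  · intro i _ j _ hij
    rw [Function.onFun, Set.disjoint_left]
    rintro ω ⟨⟨-, h1⟩, h2⟩ ⟨⟨-, h3⟩, h4⟩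
    rcases lt_or_gt_of_ne hij with hlt | hlt
    · exact h4 i hlt h1
    · exact h2 j hlt h3
  · intro k hk
    have hk' : k ≤ n := by have := Finset.mem_range.1 hk; omega
    exact (sigmaOn_le _ _ (hRH k hk')).inter (sigmaOn_le _ _ (measurableSet_miss k w (by omega)))

theorem missProb_nonneg {c q : ℝ} (h : Admissible d c q) (k : ℕ) : 0 ≤ missProb c q k := by
  have hq := h.q_pos
  have hd : (2 : ℝ) ≤ d := by exact_mod_cast h.two_le
  have hq1 : q ≤ 1 := by nlinarith [h.dq_lt_one]
  refine Finset.prod_nonneg fun i _ => ?_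
  have : c * q ^ (i + 1) ≤ 1 := mul_le_one₀ h.c_le_one (by positivity) (pow_le_one₀ hq.le hq1)
  linarith

theorem reachProb_nonneg {c q : ℝ} (h : Admissible d c q) (n : ℕ) : 0 ≤ reachProb c q n := by
  induction n using Nat.strong_induction_on with
  | _ n ih =>
  have hc := h.c_pos
  have hq := h.q_pos
  rcases n with _ | n
  · simp [reachProb_zero]
  · rw [reachProb_succ]
    refine Finset.sum_nonneg fun k _ => ?_
    exact mul_nonneg (mul_nonneg (by positivity) (missProb_nonneg h k)) (ih (n - k) (by omega))

theorem real_reach {c q : ℝ} (h : Admissible d c q) (n : ℕ) (w : Vertex d) (hn : n < w.level) :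
    (frogLaw h).real {ω | Reach ω n w} = reachProb c q n := by
  induction n using Nat.strong_induction_on generalizing w with
  | _ n ih =>
  rcases n with _ | n
  · simp [Reach.refl, reachProb_zero]
  · rw [real_reach_succ h hn.le, reachProb_succ]
    refine Finset.sum_congr rfl fun k hk => ?_
    have := Finset.mem_range.1 hk
    rw [real_hit h (by omega), ih (n - k) (by omega) _ (by rw [Vertex.level_anc]; omega)]

theorem real_reach_le {c q : ℝ} (h : Admissible d c q) (n : ℕ) (w : Vertex d) (hn : n ≤ w.level) :
    (frogLaw h).real {ω | Reach ω n w} ≤ reachProb c q n := by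
  induction n using Nat.strong_induction_on generalizing w with
  | _ n ih =>
  rcases n with _ | n
  · simp [Reach.refl, reachProb_zero]
  · rw [real_reach_succ h hn, reachProb_succ]
    refine Finset.sum_le_sum fun k hk => ?_
    have := Finset.mem_range.1 hk
    have hc := h.c_pos
    have hq := h.q_pos
    have hm := missProb_nonneg h k
    refine mul_le_mul (mul_le_mul_of_nonneg_right (real_hit_le h (by omega)) hm)
      (ih (n - k) (by omega) _ (by rw [Vertex.level_anc]; omega)) measureReal_nonneg (by positivity)

/-! ### The embedded branching process. -/

theorem Vertex.level_desc (i : Fin (d + 1)) (l g : List (Fin d)) :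
    ((Vertex.node i l).desc g).level = (Vertex.node i l).level + g.length := by
  simp [Vertex.level, Vertex.desc]; omega

theorem Vertex.anc_desc (i : Fin (d + 1)) (l g : List (Fin d)) :
    ((Vertex.node i l).desc g).anc g.length = .node i l :=
  Vertex.anc_node i g l

theorem Vertex.desc_injective (i : Fin (d + 1)) (l : List (Fin d)) :
    Function.Injective (Vertex.node i l).desc := by
  intro g g' h
  simpa [Vertex.desc] using h

/-- The vertices of the subtree that is rooted at `v`. -/
def subtree (v : Vertex d) : Set (Vertex d) := {u | ∃ k ≤ u.level, u.anc k = v}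

/-- The vertices of the subtree rooted at `v` that are less than `m` generations below `v`. -/
def topSubtree (m : ℕ) (v : Vertex d) : Set (Vertex d) := {u | ∃ k < m, k ≤ u.level ∧ u.anc k = v}

theorem topSubtree_subset (m : ℕ) (v : Vertex d) : topSubtree m v ⊆ subtree v := by
  rintro u ⟨k, -, h⟩
  exact ⟨k, h⟩

theorem level_le_of_mem_subtree {u v : Vertex d} (h : u ∈ subtree v) : v.level ≤ u.level := by
  obtain ⟨k, hk, rfl⟩ := h
  rw [Vertex.level_anc]; omega

theorem level_lt_of_mem_topSubtree {m : ℕ} {u v : Vertex d} (h : u ∈ topSubtree m v) :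
    u.level < v.level + m := by
  obtain ⟨k, hk, hu, rfl⟩ := h
  rw [Vertex.level_anc]; omega

theorem ancestors_desc_subset (i : Fin (d + 1)) (l g : List (Fin d)) :
    ancestors ((Vertex.node i l).desc g) 0 g.length ⊆ topSubtree g.length (.node i l) := by
  rintro _ ⟨k, hk, rfl⟩
  have h1 := hk.1
  have h2 := hk.2
  refine ⟨g.length - k, by omega, ?_, ?_⟩
  · rw [Vertex.level_anc, Vertex.level_desc]; omega
  · rw [← Vertex.anc_add, show g.length - k + k = g.length by omega, Vertex.anc_desc]

theorem subtree_desc_subset (i : Fin (d + 1)) (l g : List (Fin d)) :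
    subtree ((Vertex.node i l).desc g) ⊆ subtree (.node i l) := by
  rintro u ⟨k, hk, hu⟩
  have h1 := congrArg Vertex.level hu
  rw [Vertex.level_anc, Vertex.level_desc] at h1
  exact ⟨g.length + k, by omega, by rw [Vertex.anc_add, hu, Vertex.anc_desc]⟩

/-- Provides the independence of one block and the later blocks. -/
theorem disjoint_topSubtree_subtree_desc (i : Fin (d + 1)) (l g : List (Fin d)) :
    Disjoint (topSubtree g.length (.node i l)) (subtree ((Vertex.node i l).desc g)) := by
  rw [Set.disjoint_left]
  intro u h1 h2
  have h3 := level_lt_of_mem_topSubtree h1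
  have h4 := level_le_of_mem_subtree h2
  rw [Vertex.level_desc] at h4
  omega

theorem disjoint_subtree {v w : Vertex d} (hl : v.level = w.level) (h : v ≠ w) :
    Disjoint (subtree v) (subtree w) := by
  rw [Set.disjoint_left]
  rintro u ⟨k, hk, hu⟩ ⟨k', hk', hu'⟩
  have h1 := congrArg Vertex.level hu
  have h2 := congrArg Vertex.level hu'
  rw [Vertex.level_anc] at h1 h2
  obtain rfl : k = k' := by omega
  exact h (hu.symm.trans hu')

/-- Survival for `j` generations of the embedded branching process in which the children of `v` are
the vertices `m` generations below `v` that are activated by particles on the path from `v`. -/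
def BlockSurvives (m : ℕ) (ω : Config d) : ℕ → Vertex d → Prop
  | 0, _ => True
  | j + 1, v => ∃ g : Fin m → Fin d, Reach ω m (v.desc (List.ofFn g)) ∧
      BlockSurvives m ω j (v.desc (List.ofFn g))

theorem BlockSurvives.of_succ {m : ℕ} {ω : Config d} {j : ℕ} {v : Vertex d}
    (h : BlockSurvives m ω (j + 1) v) : BlockSurvives m ω j v := by
  induction j generalizing v with
  | zero => trivial
  | succ j ih =>
    obtain ⟨g, h1, h2⟩ := h
    exact ⟨g, h1, ih h2⟩

theorem BlockSurvives.exists_activatedAt {m : ℕ} {ω : Config d} {j : ℕ} {i : Fin (d + 1)}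
    {l : List (Fin d)} (h : BlockSurvives m ω j (.node i l))
    (hv : ActivatedAt ω (.node i l) (Vertex.node i l).level) :
    ∃ w : Vertex d, ActivatedAt ω w ((Vertex.node i l).level + j * m) := by
  induction j generalizing l with
  | zero => exact ⟨_, by simpa using hv⟩
  | succ j ih =>
    obtain ⟨g, h1, h2⟩ := h
    have h3 := Vertex.anc_desc i l (List.ofFn g)
    rw [List.length_ofFn] at h3
    obtain ⟨w, hw⟩ := ih h2 (h1.activatedAt (by rwa [h3]))
    refine ⟨w, ?_⟩
    have h4 := Vertex.level_desc i l (List.ofFn g)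
    rw [List.length_ofFn] at h4
    change ActivatedAt ω w (((Vertex.node i l).desc (List.ofFn g)).level + j * m) at hw
    rw [h4] at hw
    convert hw using 1
    ring

theorem measurableSet_reach_desc {m : ℕ} (i : Fin (d + 1)) (l : List (Fin d)) (g : Fin m → Fin d) :
    MeasurableSet[sigmaOn (topSubtree m (.node i l))]
      {ω : Config d | Reach ω m ((Vertex.node i l).desc (List.ofFn g))} := by
  have h1 := ancestors_desc_subset i l (List.ofFn g)
  have h2 := Vertex.level_desc i l (List.ofFn g)
  rw [List.length_ofFn] at h1 h2
  exact sigmaOn_mono h1 _ (measurableSet_reach m _ (by omega))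

theorem measurableSet_blockSurvives (m j : ℕ) (i : Fin (d + 1)) (l : List (Fin d)) :
    MeasurableSet[sigmaOn (subtree (.node i l))]
      {ω : Config d | BlockSurvives m ω j (.node i l)} := by
  induction j generalizing l with
  | zero => exact @MeasurableSet.univ _ (sigmaOn _)
  | succ j ih =>
    have : {ω : Config d | BlockSurvives m ω (j + 1) (.node i l)} = ⋃ g : Fin m → Fin d,
        {ω | Reach ω m ((Vertex.node i l).desc (List.ofFn g))} ∩
          {ω | BlockSurvives m ω j ((Vertex.node i l).desc (List.ofFn g))} := by
      ext ω
      simp [BlockSurvives]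
    rw [this]
    refine MeasurableSet.iUnion fun g => MeasurableSet.inter ?_ ?_
    · exact sigmaOn_mono (topSubtree_subset _ _) _ (measurableSet_reach_desc i l g)
    · exact sigmaOn_mono (subtree_desc_subset i l (List.ofFn g)) _ (ih _)

/-- A crude Bonferroni inequality, used to linearize the survival probability of `n` independent
children. -/
theorem one_sub_one_sub_pow_ge {ε : ℝ} (h0 : 0 ≤ ε) (h1 : ε ≤ 1) (n : ℕ) :
    n * ε - n ^ 2 * ε ^ 2 ≤ 1 - (1 - ε) ^ n := by
  induction n with
  | zero => simp
  | succ n ih =>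
    have h2 : (1 - ε) * (1 - ε) ^ n ≤ (1 - ε) * (1 - (n * ε - n ^ 2 * ε ^ 2)) :=
      mul_le_mul_of_nonneg_left (by linarith) (by linarith)
    have h3 : 0 ≤ (n : ℝ) * ε ^ 2 := by positivity
    have h4 : 0 ≤ (n : ℝ) ^ 2 * ε ^ 3 := by positivity
    rw [pow_succ' (1 - ε)]
    push_cast
    nlinarith [sq_nonneg ε]

theorem real_biUnion_ge {c q : ℝ} (h : Admissible d c q) {ι : Type*} {V : ι → Set (Vertex d)}
    (hV : Pairwise (Function.onFun Disjoint V)) {B : ι → Set (Config d)}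
    (hB : ∀ i, MeasurableSet[sigmaOn (V i)] (B i)) {ε : ℝ} (h1 : ε ≤ 1)
    (hε : ∀ i, ε ≤ (frogLaw h).real (B i)) (A : Finset ι) :
    1 - (1 - ε) ^ A.card ≤ (frogLaw h).real (⋃ i ∈ A, B i) := by
  classical
  have hm : ∀ A : Finset ι, MeasurableSet[sigmaOn (⋃ i ∈ A, V i)] (⋃ i ∈ A, B i) := fun A =>
    Finset.measurableSet_biUnion (m := sigmaOn (⋃ i ∈ A, V i)) A fun i hi =>
      sigmaOn_mono (Set.subset_biUnion_of_mem (u := V) hi) _ (hB i)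
  induction A using Finset.induction_on with
  | empty => simp
  | insert a A ha ih =>
    have hd : Disjoint (V a) (⋃ i ∈ A, V i) := by
      rw [Set.disjoint_iUnion₂_right]
      intro i hi
      exact hV fun h => ha (h ▸ hi)
    have h2 := frogLaw_real_inter h hd (hB a) (hm A)
    have h3 := measureReal_union_add_inter (μ := frogLaw h) (s := B a)
      (sigmaOn_le _ _ (hm A)) (measure_ne_top _ _) (measure_ne_top _ _)
    rw [Finset.set_biUnion_insert, Finset.card_insert_of_notMem ha, pow_succ]
    have h4 := hε a
    have h5 : (frogLaw h).real (⋃ i ∈ A, B i) ≤ 1 := measureReal_le_one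
    nlinarith

/-- With `Z ≤ d^m` the number of children and `M = E Z = d^m * reachProb c q m`, one generation
turns a lower bound `ε` into `1 - E (1 - ε)^Z ≥ ε M - d^(2m) ε^2`. By `hε` this is again at least
`ε`, so the bound is uniform in `j`. -/
theorem real_blockSurvives_ge {c q : ℝ} (h : Admissible d c q) {m : ℕ} {ε : ℝ} (h0 : 0 ≤ ε)
    (h1 : ε ≤ 1) (hε : ((d : ℝ) ^ m) ^ 2 * ε ≤ (d : ℝ) ^ m * reachProb c q m - 1) (j : ℕ)
    (i : Fin (d + 1)) (l : List (Fin d)) :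
    ε ≤ (frogLaw h).real {ω | BlockSurvives m ω j (.node i l)} := by
  classical
  induction j generalizing l with
  | zero => simpa [BlockSurvives] using h1
  | succ j ih =>
    set R : (Fin m → Fin d) → Set (Config d) := fun g =>
      {ω | Reach ω m ((Vertex.node i l).desc (List.ofFn g))} with hR
    set B : (Fin m → Fin d) → Set (Config d) := fun g =>
      {ω | BlockSurvives m ω j ((Vertex.node i l).desc (List.ofFn g))} with hB
    -- The events `R g` are dependent, so the proof conditions on the exact set `A` of reached
    -- vertices; given it, the subtrees below are independent.
    set O : Finset (Fin m → Fin d) → Set (Config d) := fun A => {ω | ∀ g, g ∈ A ↔ ω ∈ R g} with hO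
    have hRm : ∀ g, MeasurableSet[sigmaOn (topSubtree m (.node i l))] (R g) :=
      measurableSet_reach_desc i l
    have hBm : ∀ g, MeasurableSet[sigmaOn (subtree ((Vertex.node i l).desc (List.ofFn g)))] (B g) :=
      fun g => measurableSet_blockSurvives m j i _
    have hOm : ∀ A, MeasurableSet[sigmaOn (topSubtree m (.node i l))] (O A) := by
      intro A
      simp only [hO, Set.ofPred_forall]
      refine MeasurableSet.iInter fun g => ?_
      by_cases hg : g ∈ A
      · simpa [hg] using hRm g
      · have : {ω : Config d | g ∈ A ↔ ω ∈ R g} = (R g)ᶜ := by ext ω; simp [hg]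
        rw [this]
        exact (hRm g).compl
    have hOd : Pairwise (Function.onFun Disjoint O) := by
      intro A A' hA
      rw [Function.onFun, Set.disjoint_left]
      intro ω h1 h2
      exact hA (Finset.ext fun g => (h1 g).trans (h2 g).symm)
    have hV : Pairwise (Function.onFun Disjoint fun g : Fin m → Fin d =>
        subtree ((Vertex.node i l).desc (List.ofFn g))) := by
      intro g g' hg
      refine disjoint_subtree ?_ ?_
      · rw [Vertex.level_desc, Vertex.level_desc, List.length_ofFn, List.length_ofFn]
      · exact fun h => hg (List.ofFn_injective (Vertex.desc_injective i l h))
    have hUm : ∀ A : Finset (Fin m → Fin d),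
        MeasurableSet[sigmaOn (⋃ g, subtree ((Vertex.node i l).desc (List.ofFn g)))]
          (⋃ g ∈ A, B g) := fun A =>
      Finset.measurableSet_biUnion
        (m := sigmaOn (⋃ g : Fin m → Fin d, subtree ((Vertex.node i l).desc (List.ofFn g)))) A
        fun g _ => sigmaOn_mono (Set.subset_iUnion
          (fun g : Fin m → Fin d => subtree ((Vertex.node i l).desc (List.ofFn g))) g) _ (hBm g)
    have hdis : Disjoint (topSubtree m (.node i l))
        (⋃ g : Fin m → Fin d, subtree ((Vertex.node i l).desc (List.ofFn g))) := by
      rw [Set.disjoint_iUnion_right]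
      intro g
      simpa using disjoint_topSubtree_subtree_desc i l (List.ofFn g)
    have hsub : ⋃ A ∈ (Finset.univ : Finset (Finset (Fin m → Fin d))), (O A ∩ ⋃ g ∈ A, B g) ⊆
        {ω | BlockSurvives m ω (j + 1) (.node i l)} := by
      intro ω hω
      simp only [Set.mem_iUnion, Set.mem_inter_iff] at hω
      obtain ⟨A, -, hA, g, hg, hgB⟩ := hω
      exact ⟨g, (hA g).1 hg, hgB⟩
    have hcard : ∀ A : Finset (Fin m → Fin d), (A.card : ℝ) ≤ (d : ℝ) ^ m := by
      intro A
      have := Finset.card_le_univ A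
      rw [Fintype.card_fun, Fintype.card_fin, Fintype.card_fin] at this
      exact_mod_cast this
    have hmean : ∑ A, (frogLaw h).real (O A) * A.card = (d : ℝ) ^ m * reachProb c q m := by
      have e1 : ∀ g, (frogLaw h).real (R g) =
          ∑ A, if g ∈ A then (frogLaw h).real (O A) else 0 := by
        intro g
        rw [← Finset.sum_filter, ← measureReal_biUnion_finset (fun A _ A' _ hA => hOd hA)
          (fun A _ => sigmaOn_le _ _ (hOm A))]
        congr 1
        ext ω
        simp only [Set.mem_iUnion, Finset.mem_filter, Finset.mem_univ, true_and, exists_prop]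
        constructor
        · intro hω
          exact ⟨Finset.univ.filter fun g => ω ∈ R g, by simpa using hω, fun g => by simp⟩
        · rintro ⟨A, hg, hA⟩
          exact (hA g).1 hg
      have e2 : ∀ g, (frogLaw h).real (R g) = reachProb c q m := fun g =>
        real_reach h m _ (by rw [Vertex.level_desc, List.length_ofFn]; simp [Vertex.level])
      have e3 : ∑ g, (frogLaw h).real (R g) = (d : ℝ) ^ m * reachProb c q m := by
        rw [Finset.sum_congr rfl fun g _ => e2 g, Finset.sum_const, Finset.card_univ,
          Fintype.card_fun, Fintype.card_fin, Fintype.card_fin, nsmul_eq_mul]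
        push_cast
        ring
      rw [← e3, Finset.sum_congr rfl fun g _ => e1 g, Finset.sum_comm]
      refine Finset.sum_congr rfl fun A _ => ?_
      rw [← Finset.sum_filter, Finset.sum_const, nsmul_eq_mul, mul_comm]
      simp
    have htot : ∑ A, (frogLaw h).real (O A) ≤ 1 := by
      rw [← measureReal_biUnion_finset (fun A _ A' _ hA => hOd hA)
          (fun A _ => sigmaOn_le _ _ (hOm A))]
      exact measureReal_le_one
    calc ε ≤ ε * ((d : ℝ) ^ m * reachProb c q m) - ((d : ℝ) ^ m) ^ 2 * ε ^ 2 := by nlinarith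
      _ ≤ ε * ∑ A, (frogLaw h).real (O A) * A.card -
          ((d : ℝ) ^ m) ^ 2 * ε ^ 2 * ∑ A, (frogLaw h).real (O A) := by
        rw [hmean]
        have : 0 ≤ ((d : ℝ) ^ m) ^ 2 * ε ^ 2 := by positivity
        nlinarith
      _ = ∑ A, (frogLaw h).real (O A) * (A.card * ε - ((d : ℝ) ^ m) ^ 2 * ε ^ 2) := by
        rw [Finset.mul_sum, Finset.mul_sum, ← Finset.sum_sub_distrib]
        exact Finset.sum_congr rfl fun A _ => by ring
      _ ≤ ∑ A, (frogLaw h).real (O A ∩ ⋃ g ∈ A, B g) := by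
        refine Finset.sum_le_sum fun A _ => ?_
        rw [frogLaw_real_inter h hdis (hOm A) (hUm A)]
        refine mul_le_mul_of_nonneg_left ?_ measureReal_nonneg
        refine le_trans ?_ (real_biUnion_ge h hV hBm h1 (fun g => ih _) A)
        refine le_trans ?_ (one_sub_one_sub_pow_ge h0 h1 _)
        have : (A.card : ℝ) ^ 2 ≤ ((d : ℝ) ^ m) ^ 2 := by gcongr; exact hcard A
        nlinarith [sq_nonneg ε]
      _ = (frogLaw h).real (⋃ A ∈ (Finset.univ : Finset (Finset (Fin m → Fin d))),
          (O A ∩ ⋃ g ∈ A, B g)) := by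
        rw [measureReal_biUnion_finset]
        · exact fun A _ A' _ hA => (hOd hA).mono Set.inter_subset_left Set.inter_subset_left
        · exact fun A _ => (sigmaOn_le _ _ (hOm A)).inter (sigmaOn_le _ _ (hUm A))
      _ ≤ _ := measureReal_mono hsub

/-! ### Survival and the expected number of reached vertices. -/

theorem survivalProb_pos {c q : ℝ} (h : Admissible d c q) {m : ℕ} (hm : 1 ≤ m)
    (hp : 1 < (d : ℝ) ^ m * reachProb c q m) : 0 < survivalProb h := by
  have hd : (0 : ℝ) < d := by have := h.two_le; positivity
  obtain ⟨ε, hε0, hε1, hε⟩ : ∃ ε : ℝ, 0 < ε ∧ ε ≤ 1 ∧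
      ((d : ℝ) ^ m) ^ 2 * ε ≤ (d : ℝ) ^ m * reachProb c q m - 1 := by
    refine ⟨min 1 (((d : ℝ) ^ m * reachProb c q m - 1) / ((d : ℝ) ^ m) ^ 2), ?_, min_le_left _ _, ?_⟩
    · exact lt_min one_pos (div_pos (by linarith) (by positivity))
    · rw [← le_div_iff₀' (by positivity)]
      exact min_le_right _ _
  set v : Vertex d := .node 0 [] with hv
  set E : ℕ → Set (Config d) := fun t => {ω | Hit ω 1 v} ∩ {ω | BlockSurvives m ω t v} with hE
  have hHm : MeasurableSet[sigmaOn {(.root : Vertex d)}] {ω : Config d | Hit ω 1 v} :=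
    measurableSet_hit (by simp [hv, Vertex.level]) rfl
  have hSm : ∀ t, MeasurableSet[sigmaOn (subtree v)] {ω : Config d | BlockSurvives m ω t v} :=
    fun t => measurableSet_blockSurvives m t 0 []
  have hdis : Disjoint {(.root : Vertex d)} (subtree v) := by
    rw [Set.disjoint_singleton_left]
    intro hmem
    have := level_le_of_mem_subtree hmem
    simp [hv, Vertex.level] at this
  set η : ℝ := (frogLaw h).real {ω | Hit ω 1 v} * ε with hη
  have hηpos : 0 < η := mul_pos (real_hit_level_one_pos h 0) hε0
  have hEη : ∀ t, ENNReal.ofReal η ≤ frogLaw h (E t) := by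
    intro t
    rw [ENNReal.ofReal_le_iff_le_toReal (measure_ne_top _ _)]
    change η ≤ (frogLaw h).real (E t)
    rw [hE, frogLaw_real_inter h hdis hHm (hSm t)]
    exact mul_le_mul_of_nonneg_left (real_blockSurvives_ge h hε0.le hε1 hε t 0 [])
      measureReal_nonneg
  have hanti : Antitone E := antitone_nat_of_succ_le fun t ω hω => ⟨hω.1, hω.2.of_succ⟩
  have hlim := tendsto_measure_iInter_atTop (μ := frogLaw h) (s := E)
    (fun t => ((sigmaOn_le _ _ hHm).inter (sigmaOn_le _ _ (hSm t))).nullMeasurableSet) hanti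
    ⟨0, measure_ne_top _ _⟩
  have hge : ENNReal.ofReal η ≤ frogLaw h (⋂ t, E t) := ge_of_tendsto' hlim hEη
  have hsub : (⋂ t, E t) ⊆ {ω | Survives ω} := by
    intro ω hω t
    obtain ⟨h1, h2⟩ := Set.mem_iInter.1 hω t
    have h3 : ActivatedAt ω v v.level := by
      refine Reach.activatedAt (n := 0 + (0 + 1)) (.step (.refl _) h1) ?_
      exact .root
    obtain ⟨w, hw⟩ := BlockSurvives.exists_activatedAt h2 h3
    -- The vertex `w` is activated at time `1 + t * m ≥ t`.
    exact hw.exists_active t (by nlinarith)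
  refine hηpos.trans_le ?_
  rw [survivalProb, Measure.real, ← ENNReal.ofReal_le_iff_le_toReal (measure_ne_top _ _)]
  exact hge.trans (measure_mono hsub)

/-- Union bound over the `(d + 1) d^n ≤ 2 d^(n+1)` vertices of generation `n + 1`. -/
theorem survivalProb_le {c q : ℝ} (h : Admissible d c q) (n : ℕ) :
    survivalProb h ≤ 2 * ((d : ℝ) ^ (n + 1) * reachProb c q (n + 1)) := by
  have hsub : {ω : Config d | Survives ω} ⊆ ⋃ x ∈ (Finset.univ : Finset (Fin (d + 1) × (Fin n → Fin d))),
      {ω | Reach ω (n + 1) (.node x.1 (List.ofFn x.2))} := by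
    intro ω hω
    obtain ⟨w, hw, hr⟩ := Survives.exists_reach hω (n + 1)
    rcases w with _ | ⟨i, l⟩
    · simp [Vertex.level] at hw
    · obtain rfl : l.length = n := by simpa [Vertex.level] using hw
      simp only [Set.mem_iUnion]
      refine ⟨(i, l.get), Finset.mem_univ _, ?_⟩
      simpa [List.ofFn_get] using hr
  have hp := reachProb_nonneg h (n + 1)
  calc survivalProb h ≤ _ := measureReal_mono hsub (measure_ne_top _ _)
    _ ≤ ∑ x : Fin (d + 1) × (Fin n → Fin d),
        (frogLaw h).real {ω | Reach ω (n + 1) (.node x.1 (List.ofFn x.2))} :=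
      measureReal_biUnion_finset_le _ _
    _ ≤ ∑ x : Fin (d + 1) × (Fin n → Fin d), reachProb c q (n + 1) :=
      Finset.sum_le_sum fun x _ => real_reach_le h _ _ (by simp [Vertex.level])
    _ = ((d : ℝ) + 1) * (d : ℝ) ^ n * reachProb c q (n + 1) := by
      rw [Finset.sum_const, Finset.card_univ, nsmul_eq_mul]
      simp
    _ ≤ _ := by
      have hd : (1 : ℝ) ≤ d := by have := h.two_le; exact_mod_cast (by omega : 1 ≤ d)
      have : 0 ≤ (d : ℝ) ^ n * reachProb c q (n + 1) := by positivity
      rw [pow_succ]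
      nlinarith

/-! ### Renewal sequences. -/

theorem sum_range_convolution (u a : ℕ → ℝ) (N : ℕ) :
    ∑ n ∈ Finset.range N, ∑ k ∈ Finset.range (n + 1), u k * a (n - k) =
      ∑ k ∈ Finset.range N, u k * ∑ i ∈ Finset.range (N - k), a i := by
  have h1 : ∑ n ∈ Finset.range N, ∑ k ∈ Finset.range (n + 1), u k * a (n - k) =
      ∑ k ∈ Finset.range N, ∑ n ∈ Finset.Ico k N, u k * a (n - k) :=
    Finset.sum_comm' fun n k => by
      simp only [Finset.mem_range, Finset.mem_Ico]; omega
  rw [h1]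
  refine Finset.sum_congr rfl fun k _ => ?_
  rw [Finset.sum_Ico_eq_sum_range, Finset.mul_sum]
  exact Finset.sum_congr rfl fun i _ => by rw [Nat.add_sub_cancel_left]

theorem sum_range_succ_renewal {u a : ℕ → ℝ}
    (h0 : a 0 = 1) (h : ∀ n, a (n + 1) = ∑ k ∈ Finset.range (n + 1), u k * a (n - k)) (N : ℕ) :
    ∑ n ∈ Finset.range (N + 1), a n =
      1 + ∑ k ∈ Finset.range N, u k * ∑ i ∈ Finset.range (N - k), a i := by
  rw [Finset.sum_range_succ', h0, add_comm, ← sum_range_convolution]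
  simp only [h]

/-- A defective renewal sequence tends to zero. -/
theorem tendsto_zero_of_renewal {u a : ℕ → ℝ} (hu : ∀ k, 0 ≤ u k) (ha : ∀ n, 0 ≤ a n)
    (h0 : a 0 = 1) (h : ∀ n, a (n + 1) = ∑ k ∈ Finset.range (n + 1), u k * a (n - k)) {H : ℝ}
    (hH : H < 1) (hs : ∀ N, ∑ k ∈ Finset.range N, u k ≤ H) :
    Filter.Tendsto a Filter.atTop (nhds 0) := by
  -- The partial sums satisfy `S (N + 1) ≤ 1 + H * S N`, so `a` is even summable.
  have hb : ∀ N, ∑ n ∈ Finset.range N, a n ≤ 1 / (1 - H) := by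
    intro N
    have hnn : 0 ≤ ∑ n ∈ Finset.range N, a n := Finset.sum_nonneg fun n _ => ha n
    have hmono : ∀ M ≤ N, ∑ n ∈ Finset.range M, a n ≤ ∑ n ∈ Finset.range N, a n := fun M hM =>
      Finset.sum_le_sum_of_subset_of_nonneg (Finset.range_mono hM) fun n _ _ => ha n
    have h1 : ∑ k ∈ Finset.range N, u k * ∑ i ∈ Finset.range (N - k), a i ≤
        H * ∑ n ∈ Finset.range N, a n :=
      calc _ ≤ ∑ k ∈ Finset.range N, u k * ∑ n ∈ Finset.range N, a n :=
            Finset.sum_le_sum fun k _ => mul_le_mul_of_nonneg_left (hmono _ (by omega)) (hu k)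
        _ = (∑ k ∈ Finset.range N, u k) * ∑ n ∈ Finset.range N, a n := by rw [Finset.sum_mul]
        _ ≤ _ := mul_le_mul_of_nonneg_right (hs N) hnn
    have h2 := sum_range_succ_renewal h0 h N
    have h3 := Finset.sum_range_succ a N
    have h4 := ha N
    rw [le_div_iff₀ (by linarith)]
    nlinarith
  exact (summable_of_sum_range_le ha hb).tendsto_atTop_zero

/-- An excessive renewal sequence exceeds `1`. -/
theorem exists_one_lt_of_renewal {u a : ℕ → ℝ} (hu : ∀ k, 0 ≤ u k) (ha : ∀ n, 0 ≤ a n)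
    (h0 : a 0 = 1) (h : ∀ n, a (n + 1) = ∑ k ∈ Finset.range (n + 1), u k * a (n - k)) {K : ℕ}
    (hK : 1 < ∑ k ∈ Finset.range K, u k) : ∃ m, 1 ≤ m ∧ 1 < a m := by
  -- If all terms were at most `1`, the partial sums would grow at most linearly; but they gain a
  -- factor `μ > 1` every `K + 1` indices.
  by_contra! hcon
  set μ := ∑ k ∈ Finset.range K, u k with hμ
  set S : ℕ → ℝ := fun N => ∑ n ∈ Finset.range N, a n with hS
  have hle : ∀ N, S N ≤ N := by
    intro N
    calc S N ≤ ∑ n ∈ Finset.range N, (1 : ℝ) := by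
          refine Finset.sum_le_sum fun n _ => ?_
          rcases Nat.eq_zero_or_pos n with rfl | hn
          · exact h0.le
          · exact hcon n hn
      _ = N := by simp
  have hSmono : Monotone S := fun M N hM =>
    Finset.sum_le_sum_of_subset_of_nonneg (Finset.range_mono hM) fun n _ _ => ha n
  have hS0 : ∀ N, 0 ≤ S N := fun N => Finset.sum_nonneg fun n _ => ha n
  have hstep : ∀ N, μ * S N ≤ S (N + K + 1) := by
    intro N
    have h2 := sum_range_succ_renewal h0 h (N + K)
    calc μ * S N = ∑ k ∈ Finset.range K, u k * S N := by rw [hμ, Finset.sum_mul]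
      _ ≤ ∑ k ∈ Finset.range K, u k * S (N + K - k) := Finset.sum_le_sum fun k hk =>
          mul_le_mul_of_nonneg_left (hSmono (by have := Finset.mem_range.1 hk; omega)) (hu k)
      _ ≤ ∑ k ∈ Finset.range (N + K), u k * S (N + K - k) :=
          Finset.sum_le_sum_of_subset_of_nonneg (Finset.range_mono (by omega))
            fun k _ _ => mul_nonneg (hu k) (hS0 _)
      _ ≤ S (N + K + 1) := by rw [hS]; simp only; rw [h2]; linarith
  have hpow : ∀ j : ℕ, μ ^ j ≤ S (1 + j * (K + 1)) := by
    intro j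
    induction j with
    | zero => simp [hS, h0]
    | succ j ih =>
      have h3 := hstep (1 + j * (K + 1))
      rw [show 1 + (j + 1) * (K + 1) = 1 + j * (K + 1) + K + 1 by ring, pow_succ']
      exact (mul_le_mul_of_nonneg_left ih (by linarith)).trans h3
  have hlin : ∀ j : ℕ, μ ^ j ≤ (K + 2) * (j + 1) := by
    intro j
    refine ((hpow j).trans (hle _)).trans ?_
    push_cast
    have : (0 : ℝ) ≤ j := by positivity
    have : (0 : ℝ) ≤ K := by positivity
    nlinarith
  have hlim := tendsto_pow_const_div_const_pow_of_one_lt 1 hK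
  have hlim0 := tendsto_pow_const_div_const_pow_of_one_lt 0 hK
  have hlim2 : Filter.Tendsto (fun j : ℕ => ((K : ℝ) + 2) * ((j : ℝ) ^ 1 / μ ^ j + (j : ℝ) ^ 0 / μ ^ j))
      Filter.atTop (nhds 0) := by
    have := (hlim.add hlim0).const_mul ((K : ℝ) + 2)
    simpa using this
  obtain ⟨j, hj⟩ := (hlim2.eventually_lt_const (one_pos)).exists
  have h4 := hlin j
  have h5 : 0 < μ ^ j := by positivity
  rw [pow_one, pow_zero, ← add_div, ← mul_div_assoc, div_lt_one h5] at hj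
  linarith

/-! ### Rational conditions for extinction and survival. -/

/-- The coefficients of the renewal equation for the expected number of vertices reached. -/
noncomputable def renewalCoeff (d : ℕ) (c q : ℝ) (k : ℕ) : ℝ :=
  c * (d * q) ^ (k + 1) * missProb c q k

theorem renewalCoeff_nonneg {c q : ℝ} (h : Admissible d c q) (k : ℕ) :
    0 ≤ renewalCoeff d c q k := by
  have := h.dq_pos
  have := h.c_pos
  exact mul_nonneg (by positivity) (missProb_nonneg h k)

theorem pow_mul_reachProb_succ (c q : ℝ) (n : ℕ) :
    (d : ℝ) ^ (n + 1) * reachProb c q (n + 1) = ∑ k ∈ Finset.range (n + 1),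
      renewalCoeff d c q k * ((d : ℝ) ^ (n - k) * reachProb c q (n - k)) := by
  rw [reachProb_succ, Finset.mul_sum]
  refine Finset.sum_congr rfl fun k hk => ?_
  obtain ⟨i, rfl⟩ := Nat.exists_eq_add_of_le (Nat.lt_succ_iff.1 (Finset.mem_range.1 hk))
  rw [Nat.add_sub_cancel_left, renewalCoeff, mul_pow]
  ring

theorem survivalProb_eq_zero {c q : ℝ} (h : Admissible d c q) {H : ℝ} (hH : H < 1)
    (hs : ∀ N, ∑ k ∈ Finset.range N, renewalCoeff d c q k ≤ H) : survivalProb h = 0 := by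
  have hl := tendsto_zero_of_renewal (a := fun n => (d : ℝ) ^ n * reachProb c q n)
    (renewalCoeff_nonneg h) (fun n => mul_nonneg (by positivity) (reachProb_nonneg h n))
    (by simp [reachProb_zero]) (fun n => pow_mul_reachProb_succ c q n) hH hs
  have h1 := ((Filter.tendsto_add_atTop_iff_nat 1).2 hl).const_mul 2
  rw [mul_zero] at h1
  exact le_antisymm (ge_of_tendsto' h1 fun n => survivalProb_le h n) measureReal_nonneg

theorem survivalProb_pos_of_sum {c q : ℝ} (h : Admissible d c q) {K : ℕ}
    (hs : 1 < ∑ k ∈ Finset.range K, renewalCoeff d c q k) : 0 < survivalProb h := by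
  obtain ⟨m, hm, h1⟩ := exists_one_lt_of_renewal (a := fun n => (d : ℝ) ^ n * reachProb c q n)
    (renewalCoeff_nonneg h) (fun n => mul_nonneg (by positivity) (reachProb_nonneg h n))
    (by simp [reachProb_zero]) (fun n => pow_mul_reachProb_succ c q n) hs
  exact survivalProb_pos h hm h1

theorem survivalProb_pos_of_hasSum {c q : ℝ} (h : Admissible d c q) {u : ℕ → ℝ} {H : ℝ}
    (hu : HasSum u H) (hH : 1 < H) (hle : ∀ k, u k ≤ renewalCoeff d c q k) :
    0 < survivalProb h := by
  obtain ⟨K, hK⟩ := (hu.tendsto_sum_nat.eventually_const_lt hH).exists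
  exact survivalProb_pos_of_sum h (hK.trans_le (Finset.sum_le_sum fun k _ => hle k))

theorem Admissible.q_lt_half {c q : ℝ} (h : Admissible d c q) : q < 1 / 2 := by
  have hd : (2 : ℝ) ≤ d := by exact_mod_cast h.two_le
  nlinarith [h.q_pos, h.dq_lt_one]

theorem missProb_succ_le {c q : ℝ} (h : Admissible d c q) (k : ℕ) :
    missProb c q (k + 1) ≤ 1 - c * q := by
  have hc := h.c_pos
  have hq := h.q_pos
  have hh := h.q_lt_half
  have hcq : c * q ≤ 1 := by nlinarith [h.c_le_one]
  rw [missProb, Finset.prod_range_succ']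
  simp only [Nat.zero_add, pow_one]
  refine mul_le_of_le_one_left (by linarith) (Finset.prod_le_one (fun i _ => ?_) fun i _ => ?_)
  · have : c * q ^ (i + 1 + 1) ≤ 1 :=
      mul_le_one₀ h.c_le_one (by positivity) (pow_le_one₀ hq.le (by linarith))
    linarith
  · have : 0 ≤ c * q ^ (i + 1 + 1) := by positivity
    linarith

/-- The subcritical regime. -/
theorem survivalProb_eq_zero_of_lt {c q : ℝ} (h : Admissible d c q)
    (hlt : d * q * (c + 1) - c ^ 2 * q * (d * q) ^ 2 < 1) : survivalProb h = 0 := by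
  have hx := h.dq_pos
  have hx1 := h.dq_lt_one
  have hc := h.c_pos
  have hm := missProb_succ_le h
  set x : ℝ := d * q with hxd
  have h1 : 0 < 1 - x := by linarith
  have hcq : 0 ≤ 1 - c * q := (missProb_nonneg h 1).trans (hm 0)
  -- The term `k = 0` is kept exactly; in all others the product is replaced by its first factor `1
  -- - c q`. Clearing `1 - x` turns `H < 1` into `hlt`.
  refine survivalProb_eq_zero h (H := c * x + c * x ^ 2 * (1 - c * q) * (1 - x)⁻¹) ?_ ?_
  · have h2 : (c * x + c * x ^ 2 * (1 - c * q) * (1 - x)⁻¹) =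
        (c * x * (1 - x) + c * x ^ 2 * (1 - c * q)) / (1 - x) := by field_simp
    rw [h2, div_lt_one h1]
    nlinarith
  · intro N
    have hsum : HasSum (fun k => c * x ^ 2 * (1 - c * q) * x ^ k)
        (c * x ^ 2 * (1 - c * q) * (1 - x)⁻¹) :=
      (hasSum_geometric_of_lt_one hx.le hx1).mul_left _
    have hp : ∀ k, 0 ≤ c * x ^ 2 * (1 - c * q) * x ^ k := fun k => by positivity
    calc ∑ k ∈ Finset.range N, renewalCoeff d c q k
        ≤ ∑ k ∈ Finset.range (N + 1), renewalCoeff d c q k :=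
          Finset.sum_le_sum_of_subset_of_nonneg (Finset.range_mono (by omega))
            fun k _ _ => renewalCoeff_nonneg h k
      _ = ∑ k ∈ Finset.range N, renewalCoeff d c q (k + 1) + c * x := by
          rw [Finset.sum_range_succ']; simp [renewalCoeff, missProb, hxd]
      _ ≤ ∑ k ∈ Finset.range N, c * x ^ 2 * (1 - c * q) * x ^ k + c * x := by
          gcongr with k hk
          rw [renewalCoeff, ← hxd]
          calc _ ≤ c * x ^ (k + 1 + 1) * (1 - c * q) :=
                mul_le_mul_of_nonneg_left (hm k) (by positivity)
            _ = _ := by ring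
      _ ≤ _ := by
          rw [add_comm]
          gcongr
          exact sum_le_hasSum _ (fun k _ => hp k) hsum

/-- The union bound `1 - ∑_{1≤i≤k} c q^i`, with the geometric sum evaluated. -/
theorem missProb_ge {c q : ℝ} (h : Admissible d c q) (k : ℕ) :
    1 - c * (q - q ^ (k + 1)) / (1 - q) ≤ missProb c q k := by
  have hc := h.c_pos
  have hq := h.q_pos
  have hh := h.q_lt_half
  have h1q : 0 < 1 - q := by linarith
  induction k with
  | zero => simp [missProb]
  | succ k ih =>
    rw [missProb, Finset.prod_range_succ, ← missProb]
    have h1 : missProb c q k ≤ 1 := Finset.prod_le_one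
      (fun i _ => by
        have : c * q ^ (i + 1) ≤ 1 :=
          mul_le_one₀ h.c_le_one (by positivity) (pow_le_one₀ hq.le (by linarith))
        linarith)
      (fun i _ => by
        have : 0 ≤ c * q ^ (i + 1) := by positivity
        linarith)
    have h2 : c * (q - q ^ (k + 1 + 1)) / (1 - q) =
        c * (q - q ^ (k + 1)) / (1 - q) + c * q ^ (k + 1) := by
      field_simp; ring
    have h3 : 0 ≤ c * q ^ (k + 1) := by positivity
    rw [h2]
    nlinarith

/-- The supercritical regime. -/
theorem survivalProb_pos_of_gt {c q : ℝ} (h : Admissible d c q)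
    (hlt : (1 - d * q * q) + c ^ 2 * q * (d * q) ^ 2 < d * q * (c + 1) * (1 - d * q * q)) :
    0 < survivalProb h := by
  have hx := h.dq_pos
  have hx1 := h.dq_lt_one
  have hc := h.c_pos
  have hq := h.q_pos
  have hh := h.q_lt_half
  have hm := missProb_ge h
  set x : ℝ := d * q with hxd
  have h1 : 0 < 1 - x := by linarith
  have h1q : 0 < 1 - q := by linarith
  have hxq : x * q < 1 := by nlinarith
  have hxq' : 0 < 1 - x * q := by linarith
  -- With the bound of `missProb_ge` each coefficient splits into a multiple of `x^k` and a multiple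
  -- of `(x q)^k`.
  have hs := ((hasSum_geometric_of_lt_one hx.le hx1).mul_left (c * x * (1 - c * q / (1 - q)))).add
    ((hasSum_geometric_of_lt_one (by positivity : 0 ≤ x * q) hxq).mul_left
      (c ^ 2 * x * q / (1 - q)))
  refine survivalProb_pos_of_hasSum h hs ?_ fun k => ?_
  · have h2 : c * x * (1 - c * q / (1 - q)) * (1 - x)⁻¹ +
        c ^ 2 * x * q / (1 - q) * (1 - x * q)⁻¹ =
        (c * x * (1 - x * q) - c ^ 2 * q * x ^ 2) / ((1 - x) * (1 - x * q)) := by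
      field_simp
      ring
    rw [h2, one_lt_div (by positivity)]
    nlinarith
  · rw [renewalCoeff, ← hxd]
    refine le_trans (le_of_eq ?_) (mul_le_mul_of_nonneg_left (hm k) (by positivity))
    field_simp
    ring

end

/-! ### The bounds for the critical parameter. -/

/-- Needed for the lower bound, since the infimum of the empty set is `0` by convention. -/
theorem exists_survivalProb_pos {d : ℕ} {c : ℝ} (hd : 2 ≤ d) (hc : 0 < c) (hc1 : c ≤ 1) :
    ∃ (q : ℝ) (h : Admissible d c q), 0 < survivalProb h := by
  have hd' : (2 : ℝ) ≤ d := by exact_mod_cast hd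
  -- Here `x` is the value of `d q`. Letting `x → 1` is not enough: for `d = 2`, `c = 1` the
  -- survival condition becomes an equality there. With this choice `x (c + 1) - 1` is a multiple of
  -- `c`, a factor `c` cancels, and `d = 2` is the worst case.
  obtain ⟨x, hx⟩ : ∃ x : ℝ, x = 1 - c / 5 := ⟨_, rfl⟩
  have hx0 : 0 < x := by linarith
  have hx1 : x < 1 := by linarith
  have hdq : (d : ℝ) * (x / d) = x := by field_simp
  have h : Admissible d c (x / d) := ⟨hd, hc, hc1, by positivity, by rw [hdq]; exact hx1⟩
  refine ⟨x / d, h, survivalProb_pos_of_gt h ?_⟩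
  rw [hdq]
  have hq2 : x / d ≤ x / 2 := by gcongr
  have hc5 : c = 5 * (1 - x) := by linarith
  have e1 : x * (c + 1) - 1 = c * ((4 - c) / 5) := by rw [hx]; ring
  have e2 : 0 < (4 - c) / 5 * (1 - x * (x / 2)) - c * (x / 2) * x ^ 2 := by
    have h3 : (x / 2) * x ^ 2 ≤ x ^ 2 / 2 := by nlinarith [sq_nonneg x]
    have h4 : 0 < (4 - c) / 5 - x ^ 2 * ((4 - c) / 10 + c / 2) := by
      rw [hx]; nlinarith [mul_pos hc hc, mul_nonneg hc.le (sub_nonneg.2 hc1)]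
    nlinarith
  have e3 : (4 - c) / 5 * (1 - x * (x / 2)) - c * (x / 2) * x ^ 2 ≤
      (4 - c) / 5 * (1 - x * (x / d)) - c * (x / d) * x ^ 2 := by
    have h5 : (4 - c) / 5 * (x * (x / d)) ≤ (4 - c) / 5 * (x * (x / 2)) := by
      have : 0 ≤ (4 - c) / 5 := by linarith
      gcongr
    have h6 : c * (x / d) * x ^ 2 ≤ c * (x / 2) * x ^ 2 := by gcongr
    linarith
  have e4 := mul_pos hc (e2.trans_le e3)
  have e5 : (x * (c + 1) - 1) * (1 - x * (x / d)) - c ^ 2 * (x / d) * x ^ 2 =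
      c * ((4 - c) / 5 * (1 - x * (x / d)) - c * (x / d) * x ^ 2) := by rw [e1]; ring
  linarith

theorem le_criticalQ {d : ℕ} {c : ℝ} (hd : 2 ≤ d) (hc : 0 < c) (hc1 : c ≤ 1) :
    1 / (d * (c + 1) - (c / (c + 1)) ^ 2) ≤ criticalQ d c := by
  obtain ⟨q₀, h₀, h₀'⟩ := exists_survivalProb_pos hd hc hc1
  refine le_csInf ⟨q₀, h₀, h₀'⟩ ?_
  rintro q ⟨h, hθ⟩
  by_contra! hlt
  refine hθ.ne' (survivalProb_eq_zero_of_lt h ?_)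
  have hd' : (2 : ℝ) ≤ d := by exact_mod_cast hd
  have hq := h.q_pos
  have hx := h.dq_pos
  set r : ℝ := c / (c + 1) with hr
  have hr0 : 0 < r := by positivity
  have hr1 : r < 1 := by rw [hr, div_lt_one (by positivity)]; linarith
  have hpos : 0 < d * (c + 1) - r ^ 2 := by nlinarith
  rw [lt_div_iff₀ hpos] at hlt
  -- If `d q ≥ 1/(c + 1)`, then `c d q ≥ r`, and the quadratic correction is at least `q r^2`; this
  -- is the origin of `(c/(c+1))^2`.
  rcases lt_or_ge (d * q * (c + 1)) 1 with h1 | h1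
  · have : 0 ≤ c ^ 2 * q * (d * q) ^ 2 := by positivity
    linarith
  · have h2 : r ≤ c * (d * q) := by
      rw [hr, div_le_iff₀ (by positivity)]
      nlinarith
    have h3 : r ^ 2 ≤ (c * (d * q)) ^ 2 := by gcongr
    nlinarith

/-- The survival condition in the variables `s = c/(c+1)`, `y = d q (c+1)`, where `d q = (1 - s) y`.
As `s → 0` it reads `7 < 8 (1 - q^2)`, which holds at `q = 1/3` but not at `q = 1/2`; this is where
`d ≥ 3` enters. -/
theorem supercritical_polynomial_bound {s q y : ℝ} (hs : 0 < s) (hs2 : s ≤ 1 / 2) (hq : 0 < q)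
    (hq3 : q ≤ 1 / 3) (hy : y = 1 + 8 / 7 * s ^ 2 * q * (1 + q)) (hqy : 3 * q ≤ (1 - s) * y) :
    7 * y ^ 2 < 8 * (1 + q) * (1 - (1 - s) * y * q) := by
  have hsq : 0 < s * q := mul_pos hs hq
  have hy0 : 0 < y := by rw [hy]; positivity
  have hy1 : y ≤ 1 + 16 / 21 * s * q := by
    have h1 : s * (1 + q) ≤ 1 / 2 * (4 / 3) := by
      apply mul_le_mul <;> linarith
    rw [hy]
    nlinarith
  have hy2 : y ≤ 1 + 32 / 63 * s ^ 2 := by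
    have : q * (1 + q) ≤ 4 / 9 := by nlinarith
    rw [hy]
    nlinarith [sq_nonneg s]
  -- A linear majorant of `(1 - s) y`: by `hy2` and `s ≤ 1/2` the slope `-47/63` would do, and
  -- `-7/10` is rounder.
  obtain ⟨X, hX⟩ : ∃ X : ℝ, X = 1 - 7 / 10 * s := ⟨_, rfl⟩
  have hxX : (1 - s) * y ≤ X := by
    have h1 : (1 - s) * y ≤ (1 - s) * (1 + 32 / 63 * s ^ 2) :=
      mul_le_mul_of_nonneg_left hy2 (by linarith)
    have h2 : 0 < s ^ 2 * s := by positivity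
    nlinarith
  have hX0 : 0 < X := by linarith
  have hqX : q ≤ X / 3 := by linarith
  obtain ⟨k, hk⟩ : ∃ k : ℝ, k = 16 / 21 * s := ⟨_, rfl⟩
  have hk0 : 0 < k := by linarith
  have h1 : 7 * y ^ 2 ≤ 7 * (1 + k * q) ^ 2 := by
    rw [hk]; gcongr
  have h2 : 8 * (1 + q) * (1 - X * q) ≤ 8 * (1 + q) * (1 - (1 - s) * y * q) := by gcongr
  refine (h1.trans_lt ?_).trans_le h2
  -- The difference of the two sides is a concave quadratic in `q`, hence above its chord `1 + q B`
  -- over `[0, X/3]`; it suffices that the chord is positive at both ends.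
  obtain ⟨B, hB⟩ : ∃ B : ℝ, B = 8 - 8 * X - 14 * k - (8 * X + 7 * k ^ 2) * (X / 3) := ⟨_, rfl⟩
  have h3 : 1 + q * B ≤ 8 * (1 + q) * (1 - X * q) - 7 * (1 + k * q) ^ 2 := by
    have : 0 ≤ (8 * X + 7 * k ^ 2) * (q * (X / 3 - q)) := by
      have : 0 ≤ X / 3 - q := by linarith
      positivity
    rw [hB]
    nlinarith
  have h4 : 0 < 1 + X / 3 * B := by
    rw [hB, hk, hX]
    have h5 : 0 ≤ 1 / 2 - s := by linarith
    nlinarith [mul_nonneg hs.le h5, mul_nonneg (sq_nonneg s) h5, mul_nonneg hs.le (sq_nonneg (1/2 - s)),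
      mul_nonneg (mul_nonneg hs.le h5) (mul_nonneg hs.le h5), sq_nonneg (s - 1/4)]
  rcases le_or_gt 0 B with hB0 | hB0
  · nlinarith [mul_nonneg hq.le hB0]
  · nlinarith

theorem criticalQ_le {d : ℕ} {c : ℝ} (hd : 3 ≤ d) (hc : 0 < c) (hc1 : c ≤ 1) :
    criticalQ d c ≤ (F c d - √(F c d ^ 2 - 224 * c ^ 2 * (c + 1) ^ 2)) / (16 * c ^ 2) := by
  have hd' : (3 : ℝ) ≤ d := by exact_mod_cast hd
  have hd0 : (0 : ℝ) < d := by linarith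
  set Δ : ℝ := F c d ^ 2 - 224 * c ^ 2 * (c + 1) ^ 2 with hΔ
  set q : ℝ := (F c d - √Δ) / (16 * c ^ 2) with hqdef
  have hF : 0 < F c d := by
    have h1 : 1 ≤ (c + 1) ^ 3 := one_le_pow₀ (by linarith)
    rw [F]
    nlinarith
  -- The quadratic with smaller root `q` is negative at `1/d`. So its roots are real and `1/d` lies
  -- between them, which gives `d q < 1`.
  have ht : 8 * c ^ 2 * (1 / d) ^ 2 - F c d * (1 / d) + 7 * (c + 1) ^ 2 < 0 := by
    have h1 : 8 * c ^ 2 * (1 / d) ^ 2 - F c d * (1 / d) + 7 * (c + 1) ^ 2 =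
        -(c * (7 * d ^ 2 * (c + 1) ^ 2 - 8 * c * (1 + d)) / d ^ 2) := by
      rw [F]; field_simp; ring
    rw [h1, neg_lt_zero]
    have h2 : 4 * c ≤ (c + 1) ^ 2 := by nlinarith [sq_nonneg (c - 1)]
    have h3 : 7 * (d : ℝ) ^ 2 * (4 * c) ≤ 7 * d ^ 2 * (c + 1) ^ 2 := by gcongr
    have h4 : 0 < c * (28 * (d : ℝ) ^ 2 - 8 * (1 + d)) := mul_pos hc (by nlinarith)
    have h5 : 0 < 7 * (d : ℝ) ^ 2 * (c + 1) ^ 2 - 8 * c * (1 + d) := by nlinarith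
    positivity
  have hΔt : (F c d - 16 * c ^ 2 * (1 / d)) ^ 2 < Δ := by
    have : 0 < c ^ 2 := by positivity
    rw [hΔ]
    nlinarith
  have hΔ0 : 0 < Δ := (sq_nonneg _).trans_lt hΔt
  have hsq : √Δ ^ 2 = Δ := Real.sq_sqrt hΔ0.le
  have hqpos : 0 < q := by
    refine div_pos (sub_pos.2 ?_) (by positivity)
    rw [Real.sqrt_lt' hF, hΔ]
    have : 0 < 224 * c ^ 2 * (c + 1) ^ 2 := by positivity
    linarith
  have hqd : q < 1 / d := by
    rw [hqdef, div_lt_iff₀ (by positivity)]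
    have := Real.lt_sqrt_of_sq_lt hΔt
    linarith
  have hdq : d * q < 1 := by rwa [lt_div_iff₀' hd0] at hqd
  have hroot : 8 * c ^ 2 * q ^ 2 - F c d * q + 7 * (c + 1) ^ 2 = 0 := by
    have h1 : √Δ = F c d - 16 * c ^ 2 * q := by rw [hqdef]; field_simp; ring
    rw [h1, hΔ] at hsq
    have h2 : 32 * c ^ 2 * (8 * c ^ 2 * q ^ 2 - F c d * q + 7 * (c + 1) ^ 2) = 0 := by linarith
    exact (mul_eq_zero.1 h2).resolve_left (by positivity)
  have h : Admissible d c q := ⟨by omega, hc, hc1, hqpos, hdq⟩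
  refine csInf_le ⟨0, ?_⟩ ⟨h, survivalProb_pos_of_gt h ?_⟩
  · rintro q' ⟨h', -⟩
    exact h'.q_pos.le
  · obtain ⟨s, hs⟩ : ∃ s : ℝ, s = c / (c + 1) := ⟨_, rfl⟩
    obtain ⟨y, hy⟩ : ∃ y : ℝ, y = d * q * (c + 1) := ⟨_, rfl⟩
    have hs0 : 0 < s := by rw [hs]; positivity
    have hcs : c = s * (c + 1) := by rw [hs]; field_simp
    have hs1 : (1 - s) * (c + 1) = 1 := by linarith
    have hx : d * q = (1 - s) * y := by
      rw [hy]; linear_combination (-(d * q)) * hs1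
    have hs2 : s ≤ 1 / 2 := by rw [hs, div_le_div_iff₀ (by positivity) (by positivity)]; linarith
    -- This is the quadratic equation for `q`, rewritten. It makes `y - 1` an explicit multiple of
    -- `s^2 q`, which then cancels from the survival condition `(y - 1)(1 - d q^2) > s^2 q y^2`.
    have hy1 : y = 1 + 8 / 7 * s ^ 2 * q * (1 + q) := by
      have h1 : 7 * (c + 1) ^ 2 * y = 7 * (c + 1) ^ 2 * (1 + 8 / 7 * s ^ 2 * q * (1 + q)) := by
        have h2 : 8 * c ^ 2 = 8 * (s * (c + 1)) ^ 2 := by rw [← hcs]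
        rw [hy]
        rw [F] at hroot
        linear_combination -hroot + (q ^ 2 + q) * h2
      exact mul_left_cancel₀ (by positivity) h1
    have hb := supercritical_polynomial_bound hs0 hs2 hqpos (by nlinarith) hy1
      (by rw [← hx]; nlinarith)
    rw [← hx] at hb
    have h3 := mul_lt_mul_of_pos_left hb (by positivity : 0 < s ^ 2 * q)
    have h4 : s ^ 2 * q * (7 * y ^ 2) = 7 * (c ^ 2 * q * (d * q) ^ 2) := by
      have h2 : c ^ 2 = (s * (c + 1)) ^ 2 := by rw [← hcs]
      rw [h2, hy]; ring
    have h5 : s ^ 2 * q * (8 * (1 + q) * (1 - d * q * q)) = 7 * ((y - 1) * (1 - d * q * q)) := by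
      rw [hy1]; ring
    rw [h4, h5] at h3
    rw [← hy]
    linarith

end FrogTree

theorem corollary2 (d : ℕ) (c : ℝ) (hc0 : 0 < c) (hc1 : c ≤ 1) :
    (2 ≤ d → 1 / (d * (c + 1) - (c / (c + 1)) ^ 2) ≤ FrogTree.criticalQ d c) ∧
    (3 ≤ d → FrogTree.criticalQ d c ≤
      (FrogTree.F c d - √(FrogTree.F c d ^ 2 - 224 * c ^ 2 * (c + 1) ^ 2)) / (16 * c ^ 2)) :=
  ⟨fun hd => FrogTree.le_criticalQ hd hc0 hc1, fun hd => FrogTree.criticalQ_le hd hc0 hc1⟩
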